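/- Let $d\ge 0$ be an integer and let $f\colon\mathbb R^d\to\mathbb R$ be a $C^3$ function with a global minimum at $0$, $f(0)=0$, and $$\|\nabla^2 f(x)\|_{\mathrm{op}}\le L,\qquad \|\nabla^3 f(x)\|_{\mathrm{op}}\le M\qquad\text{for all }x\in\mathbb R^d,$$ where $\|A\|_{\mathrm{op}}=\sup\{|A(u_1,\dots,u_k)|:\|u_1\|=\dots=\|u_k\|=1\}$ for a $k$-linear form $A$ and $\|\cdot\|$ is the Euclidean norm. Let $T>0$ and $h\ge 0$ with $T/h\in\mathbb N$ if $h>0$, and assume $L(T^2+Th)\le \tfrac1{12}$. For $h>0$ let $\tilde q_{T,h}(x,v)$ be the position $x_N$ after $N=T/h$ velocity Verlet steps $$x_{j+1}=x_j+h v_j-\tfrac{h^2}{2}\nabla f(x_j),\qquad v_{j+1}=v_j-\tfrac h2\bigl(\nabla f(x_j)+\nabla f(x_{j+1})\bigr)$$ from $(x_0,v_0)=(x,v)$; for $h=0$ let $\tilde q_{T,0}(x,v)$ be the position at time $T$ of the solution of $\dot x_t=v_t$, $\dot v_t=-\nabla f(x_t)$ with $(x_0,v_0)=(x,v)$. Let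 $\tilde P_{T,h}$ be the Markov kernel on $\mathbb R^d$ whose transition from $x$ is the law of $\tilde q_{T,h}(x,\xi)$, where $\xi$ is a standard Gaussian vector in $\mathbb R^d$; write $\mu\tilde P_{T,h}^k$ for the law after $k$ transitions from the initial law $\mu$. Let $W_2(\mu,\pi)=\bigl(\inf_\gamma\int\|x-y\|^2\,d\gamma(x,y)\bigr)^{1/2}\in[0,\infty]$, the infimum being over all couplings $\gamma$ of $\mu$ and $\pi$. Suppose that $\tilde\nu_h$ is a probability measure on $\mathbb R^d$ with $\tilde\nu_h\tilde P_{T,h}=\tilde\nu_h$, and that $c_1\ge1$, $c_2>0$ are constants such that for every integer $k\ge1$ and every probability measure $\mu$ on $\mathbb R^d$ $$W_2(\mu\tilde P_{T,h}^k,\tilde\nu_h)\le c_1e^{-c_2k}\,W_2(\mu,\tilde\nu_h).$$ Then for every probability measure $\mu$ on $\mathbb R^d$ and every integer $k\ge0$ $$\mathrm{KL}\bigl(\mu\tilde P_{T,h}^{k+1}\,\big\|\,\tilde\nu_h\bigr)\le c_1^2e^{-2c_2k}\Bigl(\frac{9}{4T^2}+20\,d\,M^2T^4\Bigr)W_2^2(\mu,\tilde\nu_h),$$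 where $\mathrm{KL}(\mu\|\pi)=\int\log\frac{d\mu}{d\pi}\,d\mu\in[0,\infty]$ if $\mu\ll\pi$ and $\mathrm{KL}(\mu\|\pi)=\infty$ otherwise. -/

import Mathlib

open MeasureTheory ProbabilityTheory
open scoped ENNReal

namespace UHMC

/-- Position (or velocity) space: `ℝ^d` with its Euclidean norm. -/
abbrev Space (d : ℕ) : Type := EuclideanSpace ℝ (Fin d)

/-- Regularity of the potential: `f` has a global minimum at `0` with `f 0 = 0`, is of class `C³`,
and the operator norms of its second and third derivatives, viewed as multilinear forms, are
bounded by `L` and `M`. -/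
structure PotentialRegularity {d : ℕ} (f : Space d → ℝ) (L M : ℝ) : Prop where
  map_zero : f 0 = 0
  min_at_zero : ∀ x, f 0 ≤ f x
  contDiff : ContDiff ℝ 3 f
  norm_hessian_le : ∀ x, ‖iteratedFDeriv ℝ 2 f x‖ ≤ L
  norm_third_le : ∀ x, ‖iteratedFDeriv ℝ 3 f x‖ ≤ M

/-- The Hamiltonian vector field `(x, v) ↦ (v, -∇f(x))` of `H(x, v) = f(x) + ‖v‖² / 2`. -/
noncomputable def hamiltonianField {d : ℕ} (f : Space d → ℝ) (z : Space d × Space d) :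
    Space d × Space d :=
  (z.2, -gradient f z.1)

/-- `γ` solves Hamilton's equations on the time interval `[0, t]` with initial condition `z`. -/
def IsHamiltonianTrajectory {d : ℕ} (f : Space d → ℝ) (t : ℝ) (z : Space d × Space d)
    (γ : ℝ → Space d × Space d) : Prop :=
  γ 0 = z ∧ IsIntegralCurveOn γ (fun _ => hamiltonianField f) (Set.Icc 0 t)

open Classical in
/-- The exact Hamiltonian flow at time `t ≥ 0`: the value at time `t` of the solution of
Hamilton's equations started at `z`. The solution exists and is unique when `∇f` is Lipschitz;
the value is `z` by convention if there is none. -/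
noncomputable def hamiltonianFlow {d : ℕ} (f : Space d → ℝ) (t : ℝ) (z : Space d × Space d) :
    Space d × Space d :=
  if hz : ∃ γ, IsHamiltonianTrajectory f t z γ then hz.choose t else z

/-- One velocity Verlet step of size `h`. -/
noncomputable def verletStep {d : ℕ} (f : Space d → ℝ) (h : ℝ) (z : Space d × Space d) :
    Space d × Space d :=
  let x' := z.1 + h • z.2 - (h ^ 2 / 2) • gradient f z.1
  (x', z.2 - (h / 2) • (gradient f z.1 + gradient f x'))

/-- The velocity Verlet flow with integration time `T` and step size `h > 0` dividing `T`:
`T / h` Verlet steps. -/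
noncomputable def verletFlow {d : ℕ} (f : Space d → ℝ) (T h : ℝ) :
    Space d × Space d → Space d × Space d :=
  (verletStep f h)^[⌊T / h⌋₊]

/-- The position map: position component of the Verlet flow if `h > 0`, and of the exact
Hamiltonian flow if `h = 0`. -/
noncomputable def positionMap {d : ℕ} (f : Space d → ℝ) (T h : ℝ) (x v : Space d) : Space d :=
  if h = 0 then (hamiltonianFlow f T (x, v)).1 else (verletFlow f T h (x, v)).1

/-- The transition kernel of unadjusted HMC with the velocity Verlet integrator: from `x`, move to
`positionMap f T h x ξ` with `ξ` a standard Gaussian velocity. -/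
noncomputable def uhmcKernel {d : ℕ} (f : Space d → ℝ) (T h : ℝ) : Kernel (Space d) (Space d) :=
  (Kernel.id ×ₖ Kernel.const (Space d) (stdGaussian (Space d))).map
    (fun p => positionMap f T h p.1 p.2)

/-- The law after `k` transitions of `P` started from `μ`. -/
noncomputable def lawAfter {d : ℕ} (P : Kernel (Space d) (Space d)) (k : ℕ)
    (μ : Measure (Space d)) : Measure (Space d) :=
  (fun ρ => ρ.bind P)^[k] μ

/-- Couplings of `μ` and `π`. -/
def couplings {d : ℕ} (μ π : Measure (Space d)) : Set (Measure (Space d × Space d)) :=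
  {γ | γ.fst = μ ∧ γ.snd = π}

/-- The Wasserstein-2 distance, with values in `[0, ∞]`. -/
noncomputable def W₂ {d : ℕ} (μ π : Measure (Space d)) : ℝ≥0∞ :=
  (⨅ γ ∈ couplings μ π, ∫⁻ p, edist p.1 p.2 ^ 2 ∂γ) ^ (1 / 2 : ℝ)

/-- Exponential contraction of `P` in `W₂` towards its invariant distribution `ν`, with constants
`c₁ ≥ 1` and `c₂ > 0`. -/
structure W2Mixing {d : ℕ} (P : Kernel (Space d) (Space d)) (ν : Measure (Space d))
    (c₁ c₂ : ℝ) : Prop where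
  one_le : 1 ≤ c₁
  pos : 0 < c₂
  invariant : Kernel.Invariant P ν
  contraction : ∀ k : ℕ, 1 ≤ k → ∀ μ : Measure (Space d), IsProbabilityMeasure μ →
    W₂ (lawAfter P k μ) ν ≤ ENNReal.ofReal (c₁ * Real.exp (-c₂ * k)) * W₂ μ ν

end UHMC

/-!
# Relative entropy bounds for unadjusted Hamiltonian Monte Carlo

One transition of the chain regularizes: the laws of the chain after one step from `x` and from `y`
have relative entropy at most `C ‖x - y‖²` with `C = 9 / (4 T²) + 20 d M² T⁴`. By joint convexity,
averaging over a coupling of two initial laws bounds the relative entropy after one step by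
`C W₂²`. Applied to the law after `k` steps and to the invariant law `ν`, this combines with the
assumed contraction in `W₂`.

For the one-step bound, the position map `Q(x, v)` is the endpoint of a path `q` solving
`q = x + t v - K(∇f ∘ q)`, where `K` is a double integral for the exact flow and a double sum for
the Verlet integrator (`PathIntegrator`, `exactIntegrator`, `verletIntegrator`). Since
`L ‖K‖ ≤ 1 / 24`, this equation is uniquely solvable, and `v ↦ Q(x, v)` is a diffeomorphism close to
`v ↦ x + T v`. Hence there is a diffeomorphism `Φ` of the velocity space with
`Q(x, v) = Q(y, Φ v)`, and `PathIntegrator.boundary_value_estimates` and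
`PathIntegrator.norm_linear_sub_le` bound `‖Φ v - v‖` by a multiple of `‖x - y‖ / T` and
`‖DΦ - 1‖` by a multiple of `M T² ‖x - y‖`.

The relative entropy of the image of the Gaussian under `Φ` is the Gaussian mean of
`⟪v, G⟫ + ‖G‖² / 2 - log |det (1 + DG)|` with `G = Φ - id`. Stein's identity
(`integral_inner_stdGaussian`) replaces `⟪v, G⟫` by `tr DG`, which cancels the first-order part of
the logarithm (`exp_trace_le_abs_det_one_add`), so that only terms quadratic in `‖x - y‖` remain.

Relative entropy is handled throughout in dual form, as the supremum over bounded measurable `g` of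
`∫ g dρ + 1 - ∫ exp g dπ`. In this form the averaging over couplings is plain integration
(`klDiv_bind_le_W₂`), and only one passage back to `klDiv` is needed
(`klDiv_le_of_forall_bounded`).
-/

namespace UHMC

/-! ### Paths driven by a smooth force -/

section Paths

variable {X V : Type*} [TopologicalSpace X] [CompactSpace X]
  [NormedAddCommGroup V] [NormedSpace ℝ V]

/-- `H` is the derivative of the map `F` and is bounded by `L` and `M`-Lipschitz. In the application
`F` is the gradient of the potential, so the physical force is `-F`, and `H` is its Hessian. -/
structure IsSmoothForce (F : C(V, V)) (H : C(V, V →L[ℝ] V)) (L M : ℝ) : Prop where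
  hasFDerivAt : ∀ x, HasFDerivAt F (H x) x
  norm_deriv_le : ∀ x, ‖H x‖ ≤ L
  norm_deriv_sub_le : ∀ x y, ‖H x - H y‖ ≤ M * ‖x - y‖

variable (X V) in
/-- The data of a second-order equation of motion in integrated form, `q = x + t v - K(F ∘ q)`, on a
compact time set `X`: the physical time `t` of a point of `X`, the endpoint at which `t = T`, and
the linear operator `K` that turns the force along a path into a displacement. The bound
`‖K‖ ≤ T² / 2` is the displacement produced during time `T` by a unit force. Taking `X = [0, T]`
gives the exact flow, and `X = {0, …, N}` the Verlet integrator. -/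
structure PathIntegrator (T : ℝ) where
  time : C(X, ℝ)
  endpoint : X
  kernel : C(X, V) →L[ℝ] C(X, V)
  abs_time_le : ∀ s, |time s| ≤ T
  time_endpoint : time endpoint = T
  norm_kernel_le : ∀ q, ‖kernel q‖ ≤ T ^ 2 / 2 * ‖q‖

namespace IsSmoothForce

variable {F : C(V, V)} {H : C(V, V →L[ℝ] V)} {L M : ℝ}

lemma nonneg_left (hF : IsSmoothForce F H L M) : 0 ≤ L := (norm_nonneg _).trans (hF.norm_deriv_le 0)

lemma norm_sub_le (hF : IsSmoothForce F H L M) (x y : V) : ‖F x - F y‖ ≤ L * ‖x - y‖ :=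
  convex_univ.norm_image_sub_le_of_norm_hasFDerivWithin_le
    (fun z _ => (hF.hasFDerivAt z).hasFDerivWithinAt) (fun z _ => hF.norm_deriv_le z)
    (Set.mem_univ y) (Set.mem_univ x)

lemma norm_taylor_le (hF : IsSmoothForce F H L M) (hM : 0 ≤ M) (x y : V) :
    ‖F y - F x - H x (y - x)‖ ≤ M * ‖y - x‖ ^ 2 := by
  have := (convex_closedBall x ‖y - x‖).norm_image_sub_le_of_norm_hasFDerivWithin_le'
    (f := F) (f' := H) (φ := H x) (C := M * ‖y - x‖)
    (fun z _ => (hF.hasFDerivAt z).hasFDerivWithinAt)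
    (fun z hz => (hF.norm_deriv_sub_le z x).trans (by
      rw [Metric.mem_closedBall, dist_eq_norm] at hz
      gcongr))
    (Metric.mem_closedBall_self (norm_nonneg _))
    (by rw [Metric.mem_closedBall, dist_eq_norm])
  linarith [this, sq ‖y - x‖, mul_assoc M ‖y - x‖ ‖y - x‖, congrArg (M * ·) (sq ‖y - x‖)]

lemma norm_comp_sub_le (hF : IsSmoothForce F H L M) (p q : C(X, V)) :
    ‖F.comp p - F.comp q‖ ≤ L * ‖p - q‖ := by
  have h0 := hF.nonneg_left
  rw [ContinuousMap.norm_le _ (by positivity)]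
  intro s
  refine (hF.norm_sub_le (p s) (q s)).trans ?_
  gcongr
  exact (p - q).norm_coe_le_norm s

lemma norm_comp_deriv_le (hF : IsSmoothForce F H L M) (q : C(X, V)) : ‖H.comp q‖ ≤ L := by
  rw [ContinuousMap.norm_le _ hF.nonneg_left]
  exact fun s => hF.norm_deriv_le _

lemma norm_comp_deriv_sub_le (hF : IsSmoothForce F H L M) (hM : 0 ≤ M) (p q : C(X, V)) :
    ‖H.comp p - H.comp q‖ ≤ M * ‖p - q‖ := by
  rw [ContinuousMap.norm_le _ (by positivity)]
  intro s
  refine (hF.norm_deriv_sub_le (p s) (q s)).trans ?_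
  gcongr
  exact (p - q).norm_coe_le_norm s

end IsSmoothForce

/-- The operator on paths that applies the linear map `B s` at time `s`. -/
noncomputable def pointwiseApply (B : C(X, V →L[ℝ] V)) : C(X, V) →L[ℝ] C(X, V) :=
  LinearMap.mkContinuous
    { toFun := fun Y => ⟨fun s => B s (Y s), by fun_prop⟩
      map_add' := fun Y Z => by ext s; simp
      map_smul' := fun c Y => by ext s; simp } ‖B‖ (fun Y => by
    rw [ContinuousMap.norm_le _ (by positivity)]
    exact fun s => (ContinuousLinearMap.le_opNorm _ _).trans
      (mul_le_mul (B.norm_coe_le_norm s) (Y.norm_coe_le_norm s) (norm_nonneg _) (norm_nonneg B)))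

@[simp]
lemma pointwiseApply_apply (B : C(X, V →L[ℝ] V)) (Y : C(X, V)) (s : X) :
    pointwiseApply B Y s = B s (Y s) := rfl

lemma norm_pointwiseApply_apply_le (B : C(X, V →L[ℝ] V)) (Y : C(X, V)) :
    ‖pointwiseApply B Y‖ ≤ ‖B‖ * ‖Y‖ := by
  rw [ContinuousMap.norm_le _ (by positivity)]
  exact fun s => (ContinuousLinearMap.le_opNorm _ _).trans
    (mul_le_mul (B.norm_coe_le_norm s) (Y.norm_coe_le_norm s) (norm_nonneg _) (norm_nonneg B))

lemma IsSmoothForce.norm_comp_taylor_le {F : C(V, V)} {H : C(V, V →L[ℝ] V)} {L M : ℝ}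
    (hF : IsSmoothForce F H L M) (hM : 0 ≤ M) (p q : C(X, V)) :
    ‖F.comp q - F.comp p - pointwiseApply (H.comp p) (q - p)‖ ≤ M * ‖q - p‖ ^ 2 := by
  rw [ContinuousMap.norm_le _ (by positivity)]
  intro s
  refine (hF.norm_taylor_le hM (p s) (q s)).trans ?_
  gcongr
  exact (q - p).norm_coe_le_norm s

namespace PathIntegrator

lemma nonneg {T : ℝ} (S : PathIntegrator X V T) : 0 ≤ T :=
  (abs_nonneg _).trans (S.abs_time_le S.endpoint)

variable {T : ℝ} (S : PathIntegrator X V T)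

/-- The free motion `s ↦ t(s) v` started at the origin, as a linear function of `v`. -/
noncomputable def drift : V →L[ℝ] C(X, V) :=
  LinearMap.mkContinuous
    { toFun := fun v => ⟨fun s => S.time s • v, by fun_prop⟩
      map_add' := fun v w => by ext s; simp
      map_smul' := fun c v => by ext s; simp [smul_comm c] } T (fun v => by
    rw [ContinuousMap.norm_le _ (mul_nonneg S.nonneg (norm_nonneg _))]
    intro s
    simp only [LinearMap.coe_mk, AddHom.coe_mk, ContinuousMap.coe_mk, norm_smul, Real.norm_eq_abs]
    exact mul_le_mul_of_nonneg_right (S.abs_time_le s) (norm_nonneg _))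

@[simp]
lemma drift_apply (v : V) (s : X) : S.drift v s = S.time s • v := rfl

lemma norm_drift_le (v : V) : ‖S.drift v‖ ≤ T * ‖v‖ := by
  rw [ContinuousMap.norm_le _ (mul_nonneg S.nonneg (norm_nonneg _))]
  intro s
  rw [drift_apply, norm_smul, Real.norm_eq_abs]
  exact mul_le_mul_of_nonneg_right (S.abs_time_le s) (norm_nonneg _)

/-- `q` is the path started at `x` with velocity `v` under the force `-F`. -/
def IsPath (F : C(V, V)) (x v : V) (q : C(X, V)) : Prop :=
  q = ContinuousMap.const X x + S.drift v - S.kernel (F.comp q)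

variable {F : C(V, V)} {H : C(V, V →L[ℝ] V)} {L M : ℝ}

/-- The smallness condition `L T² ≤ 1/12` makes `L ‖K‖ ≤ 1/24`. -/
lemma norm_kernel_le_of_norm_le (hLT : L * T ^ 2 ≤ 1 / 12) {p : C(X, V)} {b : ℝ} (hb : 0 ≤ b)
    (hp : ‖p‖ ≤ L * b) : ‖S.kernel p‖ ≤ b / 24 := by
  have := S.norm_kernel_le p
  have h2 : T ^ 2 / 2 * ‖p‖ ≤ T ^ 2 / 2 * (L * b) := by gcongr
  nlinarith

/-- Since `L T² ≤ 1/12`, the integrated equation of motion is a fixed point problem for a contraction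
of the space of paths. -/
lemma existsUnique_isPath [CompleteSpace V] (hF : IsSmoothForce F H L M)
    (hLT : L * T ^ 2 ≤ 1 / 12) (x v : V) : ∃! q, S.IsPath F x v q := by
  set Ψ : C(X, V) → C(X, V) := fun q =>
    ContinuousMap.const X x + S.drift v - S.kernel (F.comp q) with hΨ
  have hc : ContractingWith (1 / 24) Ψ := by
    refine ⟨by norm_num, LipschitzWith.of_dist_le_mul fun p q => ?_⟩
    rw [dist_eq_norm, dist_eq_norm]
    have : Ψ p - Ψ q = S.kernel (F.comp q - F.comp p) := by
      simp only [hΨ, map_sub]; abel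
    rw [this]
    have := S.norm_kernel_le_of_norm_le hLT (norm_nonneg (q - p)) (hF.norm_comp_sub_le q p)
    rw [norm_sub_rev p q]
    push_cast
    linarith
  refine ⟨hc.fixedPoint Ψ, ?_, fun q hq => ?_⟩
  · exact (hc.fixedPoint_isFixedPt (f := Ψ)).symm
  · exact hc.fixedPoint_unique (show Function.IsFixedPt Ψ q from Eq.symm hq)

/-- A solution of the linearized path equation is controlled by its inhomogeneity. -/
lemma norm_le_of_linear_eq (hLT : L * T ^ 2 ≤ 1 / 12) {B : C(X, V →L[ℝ] V)} (hB : ‖B‖ ≤ L)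
    {Y b : C(X, V)} (hY : Y = b - S.kernel (pointwiseApply B Y)) :
    ‖Y‖ ≤ 24 / 23 * ‖b‖ ∧ ‖Y - b‖ ≤ 1 / 23 * ‖b‖ := by
  have h1 : ‖S.kernel (pointwiseApply B Y)‖ ≤ ‖Y‖ / 24 :=
    S.norm_kernel_le_of_norm_le hLT (norm_nonneg _)
      ((norm_pointwiseApply_apply_le B Y).trans (by gcongr))
  have h2 : Y - b = - S.kernel (pointwiseApply B Y) := by
    nth_rewrite 1 [hY]; abel
  have h3 : ‖Y - b‖ ≤ ‖Y‖ / 24 := by rw [h2, norm_neg]; exact h1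
  have h4 : ‖Y‖ ≤ ‖b‖ + ‖Y - b‖ := by
    have := norm_add_le b (Y - b)
    simpa using this
  constructor <;> linarith

/-- Solvability of the path equation linearized along `B`, with the solution linear in the initial
velocity `η`: the operator `1 + K B` is invertible by a Neumann series. -/
lemma exists_linear_solution [CompleteSpace V] (hLT : L * T ^ 2 ≤ 1 / 12)
    {B : C(X, V →L[ℝ] V)} (hB : ‖B‖ ≤ L) :
    ∃ D : V →L[ℝ] C(X, V), ∀ η, D η = S.drift η - S.kernel (pointwiseApply B (D η)) := by
  set a := S.kernel.comp (pointwiseApply B) with ha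
  have hn : ‖-a‖ < 1 := by
    rw [norm_neg]
    refine lt_of_le_of_lt (ContinuousLinearMap.opNorm_le_bound a (M := 1 / 24) (by norm_num)
      fun Y => ?_) (by norm_num)
    have := S.norm_kernel_le_of_norm_le hLT (norm_nonneg Y)
      ((norm_pointwiseApply_apply_le B Y).trans (by gcongr))
    simp only [ha, ContinuousLinearMap.comp_apply]
    linarith
  set u := Units.oneSub (-a) hn with hu
  refine ⟨(↑u⁻¹ : C(X, V) →L[ℝ] C(X, V)).comp S.drift, fun η => ?_⟩
  have h1 : (u : C(X, V) →L[ℝ] C(X, V)) * ↑u⁻¹ = 1 := Units.mul_inv u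
  have h2 := congrArg (fun A : C(X, V) →L[ℝ] C(X, V) => A (S.drift η)) h1
  simp only [hu, Units.val_oneSub, sub_neg_eq_add, one_apply_eq_self] at h2
  rw [eq_sub_iff_add_eq]
  exact h2

/-- Paths depend in a Lipschitz way on their initial data. -/
lemma norm_path_sub_le (hF : IsSmoothForce F H L M) (hLT : L * T ^ 2 ≤ 1 / 12) {x v y w : V}
    {p q : C(X, V)} (hp : S.IsPath F x v p) (hq : S.IsPath F y w q) :
    ‖p - q‖ ≤ 24 / 23 * (‖x - y‖ + T * ‖v - w‖) := by
  have h1 : ‖S.kernel (F.comp p - F.comp q)‖ ≤ ‖p - q‖ / 24 :=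
    S.norm_kernel_le_of_norm_le hLT (norm_nonneg _) (hF.norm_comp_sub_le p q)
  have h2 : p - q = ContinuousMap.const X (x - y) + S.drift (v - w)
      - S.kernel (F.comp p - F.comp q) := by
    rw [map_sub, map_sub]
    nth_rewrite 1 [hp, hq]
    ext s
    simp only [ContinuousMap.sub_apply, ContinuousMap.add_apply, ContinuousMap.const_apply]
    abel
  have h3 : ‖ContinuousMap.const X (x - y)‖ ≤ ‖x - y‖ :=
    (ContinuousMap.norm_le _ (norm_nonneg _)).2 fun _ => le_rfl
  have h4 : ‖p - q‖ ≤ ‖x - y‖ + T * ‖v - w‖ + ‖p - q‖ / 24 := by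
    nth_rewrite 1 [h2]
    exact (norm_sub_le _ _).trans (add_le_add ((norm_add_le _ _).trans
      (add_le_add h3 (S.norm_drift_le _))) h1)
  linarith

/-- Two paths with the same endpoint have close initial velocities and stay close: the two-point
boundary value problem is well-posed. -/
lemma boundary_value_estimates (hF : IsSmoothForce F H L M) (hLT : L * T ^ 2 ≤ 1 / 12) {x v y w : V}
    {p q : C(X, V)} (hp : S.IsPath F x v p) (hq : S.IsPath F y w q)
    (hpq : p S.endpoint = q S.endpoint) :
    T * ‖v - w‖ ≤ 12 / 11 * ‖x - y‖ ∧ ‖p - q‖ ≤ 24 / 11 * ‖x - y‖ := by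
  have h1 : ‖S.kernel (F.comp p - F.comp q)‖ ≤ ‖p - q‖ / 24 :=
    S.norm_kernel_le_of_norm_le hLT (norm_nonneg _) (hF.norm_comp_sub_le p q)
  have h2 := S.norm_path_sub_le hF hLT hp hq
  have e1 := congrArg (fun r : C(X, V) => r S.endpoint) hp
  have e2 := congrArg (fun r : C(X, V) => r S.endpoint) hq
  simp only [ContinuousMap.sub_apply, ContinuousMap.add_apply, ContinuousMap.const_apply,
    drift_apply, S.time_endpoint] at e1 e2
  have h3 : T • (v - w) = - (x - y) + S.kernel (F.comp p - F.comp q) S.endpoint := by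
    have h0 : x + T • v - S.kernel (F.comp p) S.endpoint
      = y + T • w - S.kernel (F.comp q) S.endpoint := by rw [← e1, ← e2, hpq]
    have h5 : x + T • v = y + T • w - S.kernel (F.comp q) S.endpoint
      + S.kernel (F.comp p) S.endpoint := by rw [← h0]; abel
    rw [smul_sub, map_sub, ContinuousMap.sub_apply]
    have h6 : T • v = x + T • v - x := by abel
    rw [h6, h5]; abel
  have h4 : T * ‖v - w‖ ≤ ‖x - y‖ + ‖p - q‖ / 24 := by
    have : ‖T • (v - w)‖ = T * ‖v - w‖ := by
      rw [norm_smul, Real.norm_eq_abs, abs_of_nonneg S.nonneg]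
    rw [← this, h3]
    refine (norm_add_le _ _).trans ?_
    rw [norm_neg]
    exact add_le_add le_rfl ((ContinuousMap.norm_coe_le_norm _ _).trans h1)
  constructor <;> linarith

/-- The linearized flows along two paths differ by at most the distance of the paths, with a constant
proportional to the bound `M` on the third derivative of the potential. -/
lemma norm_linear_sub_le (hF : IsSmoothForce F H L M) (hLT : L * T ^ 2 ≤ 1 / 12) (hM : 0 ≤ M)
    {p q : C(X, V)} {η : V} {Y Z : C(X, V)}
    (hY : Y = S.drift η - S.kernel (pointwiseApply (H.comp p) Y))
    (hZ : Z = S.drift η - S.kernel (pointwiseApply (H.comp q) Z)) :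
    ‖Y - Z‖ ≤ 3 / 5 * M * T ^ 3 * ‖p - q‖ * ‖η‖ := by
  have hT := S.nonneg
  have h1 : Y - Z = -S.kernel (pointwiseApply (H.comp p - H.comp q) Z)
      - S.kernel (pointwiseApply (H.comp p) (Y - Z)) := by
    have : pointwiseApply (H.comp p - H.comp q) Z
        = pointwiseApply (H.comp p) Z - pointwiseApply (H.comp q) Z := by
      ext s; simp
    rw [this]
    nth_rewrite 1 [hY, hZ]
    simp only [map_sub]
    abel
  have h2 := (S.norm_le_of_linear_eq hLT (hF.norm_comp_deriv_le p) h1).1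
  rw [norm_neg] at h2
  have h3 := S.norm_kernel_le (pointwiseApply (H.comp p - H.comp q) Z)
  have h4 := norm_pointwiseApply_apply_le (H.comp p - H.comp q) Z
  have h5 := hF.norm_comp_deriv_sub_le hM p q
  have h6 := (S.norm_le_of_linear_eq hLT (hF.norm_comp_deriv_le q) hZ).1
  have h7 := S.norm_drift_le η
  calc ‖Y - Z‖ ≤ 24 / 23 * (T ^ 2 / 2 * ((M * ‖p - q‖) * (24 / 23 * (T * ‖η‖)))) := by
        refine h2.trans ?_
        gcongr
        refine h3.trans ?_
        gcongr
        refine h4.trans ?_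
        gcongr
        exact h6.trans (by gcongr)
    _ = (288 / 529) * (M * T ^ 3 * ‖p - q‖ * ‖η‖) := by ring
    _ ≤ 3 / 5 * (M * T ^ 3 * ‖p - q‖ * ‖η‖) :=
      mul_le_mul_of_nonneg_right (by norm_num) (by positivity)
    _ = _ := by ring

/-- The linearized path equation gives the derivative of the path with respect to its initial
velocity, since the remainder solves a linear equation with a quadratically small inhomogeneity. -/
lemma hasFDerivAt_path (hF : IsSmoothForce F H L M) (hLT : L * T ^ 2 ≤ 1 / 12) (hM : 0 ≤ M)
    {x v : V} {q : V → C(X, V)} (hq : ∀ w, S.IsPath F x w (q w)) {D : V →L[ℝ] C(X, V)}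
    (hD : ∀ η, D η = S.drift η - S.kernel (pointwiseApply (H.comp (q v)) (D η))) :
    HasFDerivAt q D v := by
  have hT := S.nonneg
  rw [hasFDerivAt_iff_isLittleO]
  refine Asymptotics.IsBigO.trans_isLittleO (g := fun w => ‖w - v‖ ^ 2) ?_ ?_
  · refine Asymptotics.IsBigO.of_bound (24 / 23 * (T ^ 2 / 2 * (M * (24 / 23 * T) ^ 2)))
      (Filter.Eventually.of_forall fun w => ?_)
    set R := F.comp (q w) - F.comp (q v) - pointwiseApply (H.comp (q v)) (q w - q v) with hR
    have h1 : q w - q v - D (w - v) = -S.kernel R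
        - S.kernel (pointwiseApply (H.comp (q v)) (q w - q v - D (w - v))) := by
      have e : q w - q v = S.drift (w - v) - S.kernel (F.comp (q w) - F.comp (q v)) := by
        nth_rewrite 1 [hq w, hq v]
        simp only [map_sub]
        abel
      nth_rewrite 1 [hD, e]
      rw [hR]
      simp only [map_sub]
      abel
    have h2 := (S.norm_le_of_linear_eq hLT (hF.norm_comp_deriv_le (q v)) h1).1
    rw [norm_neg] at h2
    have h3 := S.norm_kernel_le R
    have h4 := hF.norm_comp_taylor_le hM (q v) (q w)
    have h5 : ‖q w - q v‖ ≤ 24 / 23 * T * ‖w - v‖ := by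
      have := S.norm_path_sub_le hF hLT (hq w) (hq v)
      rw [sub_self, norm_zero, zero_add] at this
      linarith
    rw [Real.norm_of_nonneg (by positivity)]
    calc _ ≤ 24 / 23 * (T ^ 2 / 2 * (M * (24 / 23 * T * ‖w - v‖) ^ 2)) := by
          refine h2.trans ?_
          gcongr
          refine h3.trans ?_
          gcongr
          refine h4.trans ?_
          gcongr
      _ = _ := by ring
  · have := Asymptotics.isLittleO_norm_pow_id (E' := V) (n := 2) (by norm_num)
    have h2 : Filter.Tendsto (fun w => w - v) (nhds v) (nhds 0) := by
      have : Filter.Tendsto (fun w => w - v) (nhds v) (nhds (v - v)) :=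
        (continuous_id.sub continuous_const).tendsto v
      rwa [sub_self] at this
    exact this.comp_tendsto h2

end PathIntegrator

end Paths

/-! ### Determinants of perturbations of the identity -/

section Determinant

variable {E : Type*} [NormedAddCommGroup E] [InnerProductSpace ℝ E] [FiniteDimensional ℝ E]

/-- A determinant bound by the Hilbert–Schmidt norm: apply `s ≤ exp (s - 1)` to the squares `s` of
the singular values. -/
lemma det_sq_le_exp_trace (B : E →ₗ[ℝ] E) {n : ℕ} (hn : Module.finrank ℝ E = n) :
    LinearMap.det B ^ 2
      ≤ Real.exp (LinearMap.trace ℝ E (LinearMap.adjoint B ∘ₗ B) - n) := by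
  have hS : (LinearMap.adjoint B ∘ₗ B).IsPositive := B.isPositive_adjoint_comp_self
  have h1 : LinearMap.det B ^ 2 = LinearMap.det (LinearMap.adjoint B ∘ₗ B) := by
    have := LinearMap.normDet_sq (𝕜 := ℝ) B
    rw [LinearMap.normDet_eq_abs_det] at this
    simpa using this
  rw [h1, hS.isSymmetric.det_eq_prod_eigenvalues hn, hS.isSymmetric.trace_eq_sum_eigenvalues hn]
  have h2 : (∑ i, (hS.isSymmetric.eigenvalues hn i : ℝ)) - n
      = ∑ i, (hS.isSymmetric.eigenvalues hn i - 1) := by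
    simp [Finset.sum_sub_distrib]
  simp only [RCLike.ofReal_real_eq_id, id] at h2 ⊢
  rw [h2, Real.exp_sum]
  refine Finset.prod_le_prod (fun i _ => hS.nonneg_eigenvalues hn i) fun i _ => ?_
  have := Real.add_one_le_exp (hS.isSymmetric.eigenvalues hn i - 1)
  linarith

lemma abs_trace_le (A : E →L[ℝ] E) {n : ℕ} (hn : Module.finrank ℝ E = n) :
    |LinearMap.trace ℝ E A| ≤ n * ‖A‖ := by
  rw [LinearMap.trace_eq_sum_inner _ (stdOrthonormalBasis ℝ E)]
  refine (Finset.abs_sum_le_sum_abs _ _).trans ?_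
  refine (Finset.sum_le_sum (g := fun _ => ‖A‖) fun i _ => ?_).trans ?_
  · refine (abs_real_inner_le_norm _ _).trans ?_
    have h := A.le_opNorm (stdOrthonormalBasis ℝ E i)
    simp only [OrthonormalBasis.norm_eq_one, mul_one, one_mul] at h ⊢
    exact h
  · simp [hn]

/-- For a small perturbation `1 + A` of the identity, `log |det (1 + A)|` equals `tr A` up to an
error of second order. -/
lemma exp_trace_le_abs_det_one_add (A : E →L[ℝ] E) (hA : ‖A‖ ≤ 1 / 2) {n : ℕ}
    (hn : Module.finrank ℝ E = n) :
    Real.exp (LinearMap.trace ℝ E A - 4 * n * ‖A‖ ^ 2)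
      ≤ |(1 + A : E →L[ℝ] E).det| := by
  have hlt : ‖-A‖ < 1 := by rw [norm_neg]; linarith
  -- `C = A (1 + A)⁻¹`, so that `(1 + A)⁻¹ = 1 - C` and `tr A - tr C = tr (A C)` is quadratic in `A`
  set u := Units.oneSub (-A) hlt with hu
  have hu1 : (u : E →L[ℝ] E) = 1 + A := by simp [hu]
  set B : E →L[ℝ] E := ↑u⁻¹ with hB
  have hAB : (1 + A) * B = 1 := by rw [← hu1]; exact Units.mul_inv u
  set C := A * B with hC
  have hBC : B = 1 - C := by
    rw [eq_sub_iff_add_eq, hC, ← hAB]; noncomm_ring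
  have hCA : ‖C‖ ≤ 2 * ‖A‖ := by
    have h1 : C = A - A * C := by
      rw [hC]; nth_rewrite 1 [hBC]; noncomm_ring
    have h2 : ‖C‖ ≤ ‖A‖ + ‖A‖ * ‖C‖ := by
      nth_rewrite 1 [h1]
      exact (norm_sub_le _ _).trans (by gcongr; exact norm_mul_le _ _)
    nlinarith [norm_nonneg C, norm_nonneg A]
  have htr : LinearMap.trace ℝ E A - LinearMap.trace ℝ E C
      = LinearMap.trace ℝ E (A * C : E →L[ℝ] E) := by
    rw [← map_sub, ← ContinuousLinearMap.toLinearMap_sub]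
    congr 2
    rw [hC]; nth_rewrite 1 [hBC]; rw [hC]; noncomm_ring
  have htr2 : LinearMap.trace ℝ E (A * C : E →L[ℝ] E) ≤ n * (2 * ‖A‖ ^ 2) := by
    refine (le_abs_self _).trans ((abs_trace_le _ hn).trans ?_)
    gcongr
    refine (norm_mul_le _ _).trans ?_
    nlinarith [norm_nonneg A]
  set e := stdOrthonormalBasis ℝ E
  have hS : LinearMap.trace ℝ E (LinearMap.adjoint (B : E →ₗ[ℝ] E) ∘ₗ (B : E →ₗ[ℝ] E)) - n
      = - 2 * LinearMap.trace ℝ E C + ∑ i, ‖C (e i)‖ ^ 2 := by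
    rw [LinearMap.trace_eq_sum_inner _ e, LinearMap.trace_eq_sum_inner _ e]
    have : ∀ i, inner ℝ (e i)
        ((LinearMap.adjoint (B : E →ₗ[ℝ] E) ∘ₗ (B : E →ₗ[ℝ] E)) (e i))
        = 1 - 2 * inner ℝ (e i) (C (e i)) + ‖C (e i)‖ ^ 2 := by
      intro i
      rw [LinearMap.comp_apply, LinearMap.adjoint_inner_right, hBC]
      simp only [ContinuousLinearMap.coe_coe, sub_apply, one_apply_eq_self]
      rw [real_inner_self_eq_norm_sq, norm_sub_sq_real, OrthonormalBasis.norm_eq_one]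
      ring
    simp only [this, Finset.sum_add_distrib, Finset.sum_sub_distrib, ← Finset.mul_sum]
    simp only [Finset.sum_const, Finset.card_univ, Fintype.card_fin, hn, nsmul_eq_mul, mul_one,
      ContinuousLinearMap.coe_coe]
    ring
  have hS2 : ∑ i, ‖C (e i)‖ ^ 2 ≤ n * (2 * ‖A‖) ^ 2 := by
    refine (Finset.sum_le_sum (g := fun _ => (2 * ‖A‖) ^ 2) fun i _ => ?_).trans (by simp [hn])
    have h := C.le_opNorm (e i)
    rw [OrthonormalBasis.norm_eq_one, mul_one] at h
    gcongr
    exact h.trans hCA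
  have hdet : (1 + A : E →L[ℝ] E).det * LinearMap.det (B : E →ₗ[ℝ] E) = 1 := by
    have := congrArg (fun D : E →L[ℝ] E => LinearMap.det (D : E →ₗ[ℝ] E)) hAB
    simp only [ContinuousLinearMap.toLinearMap_mul, map_mul] at this
    rw [ContinuousLinearMap.det, this]
    exact LinearMap.det_id
  have hd := det_sq_le_exp_trace (B : E →ₗ[ℝ] E) hn
  set δ := LinearMap.det (B : E →ₗ[ℝ] E) with hδ
  set s := LinearMap.trace ℝ E A - 4 * n * ‖A‖ ^ 2 with hs
  have h3 : δ ^ 2 ≤ Real.exp (-s) ^ 2 := by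
    refine hd.trans ?_
    rw [← Real.exp_nat_mul, Real.exp_le_exp, hS]
    push_cast
    nlinarith
  have h4 : |δ| ≤ Real.exp (-s) := abs_le_of_sq_le_sq h3 (Real.exp_pos _).le
  have h5 : |(1 + A : E →L[ℝ] E).det| * |δ| = 1 := by rw [← abs_mul, hdet, abs_one]
  have h6 : 1 ≤ |(1 + A : E →L[ℝ] E).det| * Real.exp (-s) := by
    rw [← h5]; gcongr
  calc Real.exp s = Real.exp s * 1 := by ring
    _ ≤ Real.exp s * (|(1 + A : E →L[ℝ] E).det| * Real.exp (-s)) := by gcongr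
    _ = |(1 + A : E →L[ℝ] E).det| * (Real.exp s * Real.exp (-s)) := by ring
    _ = _ := by rw [← Real.exp_add, add_neg_cancel, Real.exp_zero, mul_one]

end Determinant

/-! ### Gaussian integration by parts and change of variables -/

section Gaussian

variable {E : Type*} [NormedAddCommGroup E] [InnerProductSpace ℝ E]

/-- The Lebesgue density of the standard Gaussian measure. -/
noncomputable def gaussianDensity (v : E) : ℝ :=
  ((2 * Real.pi) ^ (Module.finrank ℝ E / 2 : ℝ))⁻¹ * Real.exp (-(1 / 2) * ‖v‖ ^ 2)

lemma gaussianDensity_pos (v : E) : 0 < gaussianDensity v := by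
  unfold gaussianDensity; positivity

lemma continuous_gaussianDensity : Continuous (gaussianDensity : E → ℝ) := by
  unfold gaussianDensity; fun_prop

lemma hasFDerivAt_gaussianDensity (v : E) :
    HasFDerivAt (gaussianDensity : E → ℝ) (-(gaussianDensity v) • innerSL ℝ v) v := by
  have h1 := ((hasStrictFDerivAt_norm_sq v).hasFDerivAt.const_mul (-(1 / 2) : ℝ)).exp.const_mul
    (((2 * Real.pi) ^ (Module.finrank ℝ E / 2 : ℝ))⁻¹)
  convert! h1 using 1
  ext w
  simp [gaussianDensity, mul_assoc]

variable [FiniteDimensional ℝ E] [MeasurableSpace E] [BorelSpace E]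

/-- The Gaussian measure has the expected density because the characteristic functions agree. -/
lemma stdGaussian_eq_withDensity :
    stdGaussian E = volume.withDensity fun v => ENNReal.ofReal (gaussianDensity v) := by
  have hm : Measurable fun v : E => ENNReal.ofReal (gaussianDensity v) :=
    continuous_gaussianDensity.measurable.ennreal_ofReal
  have hint : Integrable (gaussianDensity : E → ℝ) := by
    have := GaussianFourier.integrable_cexp_neg_mul_sq_norm_add (V := E) (b := 1 / 2)
      (by norm_num) 0 0
    have := this.norm.const_mul ((2 * Real.pi) ^ (Module.finrank ℝ E / 2 : ℝ))⁻¹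
    refine this.congr (Filter.Eventually.of_forall fun v => ?_)
    simp only [gaussianDensity, Complex.norm_exp, inner_zero_left]
    congr 2
    norm_cast
    simp [-Complex.ofReal_pow]
  have : IsFiniteMeasure (volume.withDensity fun v : E => ENNReal.ofReal (gaussianDensity v)) :=
    isFiniteMeasure_withDensity_ofReal hint.2
  refine Measure.ext_of_charFun (funext fun t => ?_)
  rw [charFun_stdGaussian, charFun_apply, integral_withDensity_eq_integral_toReal_smul hm
    (Filter.Eventually.of_forall fun _ => ENNReal.ofReal_lt_top)]
  have h1 : ∀ v : E, (ENNReal.ofReal (gaussianDensity v)).toReal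
        • Complex.exp ((inner ℝ v t : ℝ) * Complex.I)
      = ((2 * Real.pi : ℂ) ^ (Module.finrank ℝ E / 2 : ℂ))⁻¹
        * Complex.exp (-(1 / 2) * ‖v‖ ^ 2 + Complex.I * (inner ℝ t v : ℝ)) := by
    intro v
    rw [ENNReal.toReal_ofReal (gaussianDensity_pos v).le, gaussianDensity, Complex.real_smul,
      Complex.exp_add, real_inner_comm]
    push_cast
    rw [Complex.ofReal_cpow (by positivity)]
    push_cast
    ring_nf
  simp only [h1]
  rw [integral_const_mul, GaussianFourier.integral_cexp_neg_mul_sq_norm_add (by norm_num)]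
  have h2 : (Real.pi / (1 / 2) : ℂ) = 2 * Real.pi := by ring
  rw [h2, ← mul_assoc, inv_mul_cancel₀, one_mul, Complex.I_sq]
  · congr 1; ring
  · rw [Complex.cpow_ne_zero_iff]
    left
    exact_mod_cast (by positivity : (2 * Real.pi) ≠ 0)

lemma integral_stdGaussian (φ : E → ℝ) :
    ∫ v, φ v ∂(stdGaussian E) = ∫ v, gaussianDensity v * φ v := by
  rw [stdGaussian_eq_withDensity, integral_withDensity_eq_integral_toReal_smul
    continuous_gaussianDensity.measurable.ennreal_ofReal
    (Filter.Eventually.of_forall fun _ => ENNReal.ofReal_lt_top)]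
  simp [ENNReal.toReal_ofReal (gaussianDensity_pos _).le]

lemma integrable_stdGaussian_iff {φ : E → ℝ} :
    Integrable φ (stdGaussian E) ↔ Integrable fun v => gaussianDensity v * φ v := by
  rw [stdGaussian_eq_withDensity, integrable_withDensity_iff_integrable_smul'
    continuous_gaussianDensity.measurable.ennreal_ofReal
    (Filter.Eventually.of_forall fun _ => ENNReal.ofReal_lt_top)]
  simp [ENNReal.toReal_ofReal (gaussianDensity_pos _).le]

/-- One-directional Gaussian integration by parts. -/
lemma integral_inner_mul_stdGaussian {u : E → ℝ} (hu : Differentiable ℝ u) {a b : ℝ}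
    (ha : ∀ v, |u v| ≤ a) (e : E) (hb : ∀ v, |fderiv ℝ u v e| ≤ b) :
    Integrable (fun v => inner ℝ v e * u v) (stdGaussian E) ∧
    Integrable (fun v => fderiv ℝ u v e) (stdGaussian E) ∧
    ∫ v, inner ℝ v e * u v ∂(stdGaussian E) = ∫ v, fderiv ℝ u v e ∂(stdGaussian E) := by
  have i1 : Integrable u (stdGaussian E) :=
    Integrable.of_bound hu.continuous.aestronglyMeasurable a (Filter.Eventually.of_forall ha)
  have i2 : Integrable (fun v => fderiv ℝ u v e) (stdGaussian E) :=
    Integrable.of_bound (measurable_fderiv_apply_const ℝ u e).aestronglyMeasurable b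
      (Filter.Eventually.of_forall hb)
  have i0 : Integrable (fun v : E => inner ℝ v e) (stdGaussian E) :=
    (IsGaussian.integrable_id (μ := stdGaussian E)).inner_const e
  have i3 : Integrable (fun v => inner ℝ v e * u v) (stdGaussian E) :=
    i0.mul_bdd (c := a) hu.continuous.aestronglyMeasurable (Filter.Eventually.of_forall ha)
  refine ⟨i3, i2, ?_⟩
  rw [integral_stdGaussian, integral_stdGaussian]
  have hd : ∀ v : E, fderiv ℝ gaussianDensity v e = -(gaussianDensity v * inner ℝ v e) := by
    intro v
    rw [(hasFDerivAt_gaussianDensity v).fderiv]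
    simp
  rw [integral_mul_fderiv_eq_neg_fderiv_mul_of_integrable (f := gaussianDensity) (g := u)
    (v := e)]
  · rw [← integral_neg]
    congr 1
    ext v
    rw [hd]
    ring
  · have := (integrable_stdGaussian_iff.1 i3).neg
    refine this.congr (Filter.Eventually.of_forall fun v => ?_)
    simp only [Pi.neg_apply, hd]
    ring
  · exact integrable_stdGaussian_iff.1 i2
  · exact integrable_stdGaussian_iff.1 i1
  · exact fun v _ => (hasFDerivAt_gaussianDensity v).differentiableAt
  · exact fun v _ => hu v

/-- **Stein's identity** for the standard Gaussian measure. -/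
lemma integral_inner_stdGaussian {G : E → E} {G' : E → E →L[ℝ] E}
    (hG : ∀ v, HasFDerivAt G (G' v) v) {a b : ℝ} (ha : ∀ v, ‖G v‖ ≤ a) (hb : ∀ v, ‖G' v‖ ≤ b) :
    Integrable (fun v => inner ℝ v (G v)) (stdGaussian E) ∧
    Integrable (fun v => LinearMap.trace ℝ E (G' v)) (stdGaussian E) ∧
    ∫ v, inner ℝ v (G v) ∂(stdGaussian E) = ∫ v, LinearMap.trace ℝ E (G' v) ∂(stdGaussian E) := by
  set e := stdOrthonormalBasis ℝ E
  have hu : ∀ i v, HasFDerivAt (fun v => inner ℝ (e i) (G v)) ((innerSL ℝ (e i)).comp (G' v)) v :=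
    fun i v => (innerSL ℝ (e i)).hasFDerivAt.comp v (hG v)
  have key := fun i => integral_inner_mul_stdGaussian (u := fun v => inner ℝ (e i) (G v))
    (fun v => (hu i v).differentiableAt) (a := a) (b := b)
    (fun v => (abs_real_inner_le_norm _ _).trans (by
      rw [OrthonormalBasis.norm_eq_one, one_mul]; exact ha v)) (e i)
    (fun v => by
      rw [(hu i v).fderiv]
      refine (abs_real_inner_le_norm _ _).trans ?_
      rw [OrthonormalBasis.norm_eq_one, one_mul]
      have := (G' v).le_opNorm (e i)
      rw [OrthonormalBasis.norm_eq_one, mul_one] at this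
      exact this.trans (hb v))
  have e1 : (fun v => inner ℝ v (G v)) = fun v => ∑ i, inner ℝ v (e i) * inner ℝ (e i) (G v) := by
    ext v
    rw [e.sum_inner_mul_inner]
  have e2 : (fun v => LinearMap.trace ℝ E (G' v))
      = fun v => ∑ i, fderiv ℝ (fun v => inner ℝ (e i) (G v)) v (e i) := by
    ext v
    rw [LinearMap.trace_eq_sum_inner _ e]
    refine Finset.sum_congr rfl fun i _ => ?_
    rw [(hu i v).fderiv]
    simp
  rw [e1, e2]
  refine ⟨integrable_finsetSum _ fun i _ => (key i).1,
    integrable_finsetSum _ fun i _ => (key i).2.1, ?_⟩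
  rw [integral_finsetSum _ fun i _ => (key i).1, integral_finsetSum _ fun i _ => (key i).2.1]
  exact Finset.sum_congr rfl fun i _ => (key i).2.2

/-- A Gaussian change of variables inequality: if `Φ` is a diffeomorphism at bounded
`C¹`-distance from the identity, then the relative entropy of the image of the standard Gaussian
under `Φ` is controlled, here in dual form. -/
lemma integral_add_one_sub_integral_exp_le_of_diffeo (Φ : E ≃ₜ E) {Φ' : E → E →L[ℝ] E}
    (hΦ : ∀ v, HasFDerivAt Φ (Φ' v) v) {a β : ℝ} (ha : ∀ v, ‖Φ v - v‖ ≤ a)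
    (hβ : ∀ v, ‖Φ' v - 1‖ ≤ β) (hhalf : ∀ v, ‖Φ' v - 1‖ ≤ 1 / 2) {n : ℕ}
    (hn : Module.finrank ℝ E = n) {g : E → ℝ}
    (hg : Measurable g) {b : ℝ} (hgb : ∀ v, |g v| ≤ b) :
    ∫ v, g (Φ v) ∂(stdGaussian E) + 1 - ∫ w, Real.exp (g w) ∂(stdGaussian E)
      ≤ a ^ 2 / 2 + 4 * n * β ^ 2 := by
  have hstein := integral_inner_stdGaussian (G := fun v => Φ v - v) (G' := fun v => Φ' v - 1)
    (fun v => (hΦ v).sub (hasFDerivAt_id v)) ha hhalf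
  obtain ⟨i1, i2, hst⟩ := hstein
  set C := a ^ 2 / 2 + 4 * n * β ^ 2 with hC
  -- `ℓ` bounds from above the logarithm of the density ratio of the Gaussian and its pullback by `Φ`;
  -- by Stein's identity its integral is `C`
  set ℓ : E → ℝ := fun v => inner ℝ v (Φ v - v)
    - LinearMap.trace ℝ E ((Φ' v - 1 : E →L[ℝ] E) : E →ₗ[ℝ] E) + C with hℓ
  have iℓ : Integrable ℓ (stdGaussian E) := (i1.sub i2).add (integrable_const C)
  have hℓint : ∫ v, ℓ v ∂(stdGaussian E) = C := by
    have h1 : ∫ v, ℓ v ∂(stdGaussian E) = _ := integral_add (i1.sub i2) (integrable_const C)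
    have h2 := integral_sub i1 i2
    rw [h1]
    rw [h2, hst]
    simp
  have ig : Integrable (fun v => g (Φ v)) (stdGaussian E) :=
    Integrable.of_bound (hg.comp Φ.continuous.measurable).aestronglyMeasurable b
      (Filter.Eventually.of_forall fun v => hgb _)
  have iexp : Integrable (fun w => Real.exp (g w)) (stdGaussian E) :=
    Integrable.of_bound hg.exp.aestronglyMeasurable (Real.exp b)
      (Filter.Eventually.of_forall fun v => by
        rw [Real.norm_of_nonneg (Real.exp_pos _).le]
        exact Real.exp_le_exp.2 ((le_abs_self _).trans (hgb _)))
  -- change of variables in the exponential integral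
  have himg : Φ '' Set.univ = Set.univ := by simp
  have hcv := integral_image_eq_integral_abs_det_fderiv_smul volume MeasurableSet.univ
    (fun v _ => (hΦ v).hasFDerivWithinAt) (Φ.injective.injOn (s := Set.univ))
    (fun w => gaussianDensity w * Real.exp (g w))
  have hcvi := (integrableOn_image_iff_integrableOn_abs_det_fderiv_smul volume MeasurableSet.univ
    (fun v _ => (hΦ v).hasFDerivWithinAt) (Φ.injective.injOn (s := Set.univ))
    (fun w => gaussianDensity w * Real.exp (g w))).1
    (by rw [himg, integrableOn_univ]; exact integrable_stdGaussian_iff.1 iexp)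
  rw [himg, setIntegral_univ, setIntegral_univ, ← integral_stdGaussian] at hcv
  rw [integrableOn_univ] at hcvi
  -- `exp (g - ℓ) ≥ 1 + g - ℓ` linearizes the exponential integral
  have hpt : ∀ v, gaussianDensity v * (1 + g (Φ v) - ℓ v)
      ≤ |(Φ' v).det| • (gaussianDensity (Φ v) * Real.exp (g (Φ v))) := by
    intro v
    have hdet := exp_trace_le_abs_det_one_add (Φ' v - 1) (hhalf v) hn
    rw [add_sub_cancel] at hdet
    have hdens : gaussianDensity (Φ v) = gaussianDensity v
        * Real.exp (-(inner ℝ v (Φ v - v) + ‖Φ v - v‖ ^ 2 / 2)) := by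
      unfold gaussianDensity
      rw [mul_assoc, ← Real.exp_add]
      congr 2
      have : Φ v = v + (Φ v - v) := by abel
      nth_rewrite 1 [this]
      rw [norm_add_sq_real]
      ring
    have hβ' : ‖Φ' v - 1‖ ^ 2 ≤ β ^ 2 := by gcongr; exact hβ v
    have ha' : ‖Φ v - v‖ ^ 2 ≤ a ^ 2 := by gcongr; exact ha v
    have hnn : 4 * (n : ℝ) * ‖Φ' v - 1‖ ^ 2 ≤ 4 * n * β ^ 2 := by gcongr
    have hexp : 1 + g (Φ v) - ℓ v ≤ Real.exp (LinearMap.trace ℝ E ((Φ' v - 1 : E →L[ℝ] E))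
        - 4 * n * ‖Φ' v - 1‖ ^ 2) * (Real.exp (-(inner ℝ v (Φ v - v) + ‖Φ v - v‖ ^ 2 / 2))
        * Real.exp (g (Φ v))) := by
      rw [← Real.exp_add, ← Real.exp_add]
      refine le_trans ?_ (Real.add_one_le_exp _)
      simp only [hℓ, hC]
      linarith
    rw [hdens, smul_eq_mul]
    calc _ ≤ gaussianDensity v * (Real.exp (LinearMap.trace ℝ E ((Φ' v - 1 : E →L[ℝ] E))
        - 4 * n * ‖Φ' v - 1‖ ^ 2) * (Real.exp (-(inner ℝ v (Φ v - v) + ‖Φ v - v‖ ^ 2 / 2))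
        * Real.exp (g (Φ v)))) := mul_le_mul_of_nonneg_left hexp (gaussianDensity_pos v).le
      _ ≤ gaussianDensity v * (|(Φ' v).det|
          * (Real.exp (-(inner ℝ v (Φ v - v) + ‖Φ v - v‖ ^ 2 / 2)) * Real.exp (g (Φ v)))) := by
        gcongr
        exact (gaussianDensity_pos v).le
      _ = _ := by ring
  have iL : Integrable (fun v => 1 + g (Φ v) - ℓ v) (stdGaussian E) :=
    ((integrable_const 1).add ig).sub iℓ
  have hle := integral_mono (integrable_stdGaussian_iff.1 iL) hcvi hpt
  have hsplit : ∫ v, 1 + g (Φ v) - ℓ v ∂(stdGaussian E)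
      = ∫ _, 1 ∂(stdGaussian E) + ∫ v, g (Φ v) ∂(stdGaussian E) - C := by
    rw [← hℓint, ← integral_add (integrable_const 1) ig]
    exact integral_sub ((integrable_const 1).add ig) iℓ
  rw [← hcv, ← integral_stdGaussian, hsplit] at hle
  simp only [integral_const, probReal_univ, smul_eq_mul, mul_one] at hle
  linarith

end Gaussian

/-! ### Coupling the images of a Gaussian under two maps -/

section NearLinear

variable {E : Type*} [NormedAddCommGroup E] [InnerProductSpace ℝ E] [FiniteDimensional ℝ E]

/-- A map whose derivative is uniformly close to `T • id` is a homeomorphism. -/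
lemma exists_homeomorph_of_deriv_near_smul {T : ℝ} (hT : 0 < T) {A : E → E} {A' : E → E →L[ℝ] E}
    (hA : ∀ v, HasFDerivAt A (A' v) v) (hA' : ∀ v η, ‖A' v η - T • η‖ ≤ T / 23 * ‖η‖) :
    ∃ e : E ≃ₜ E, ∀ v, e v = A v := by
  have hd : ∀ v, HasFDerivAt (fun v => T⁻¹ • A v) (T⁻¹ • A' v) v := fun v => (hA v).const_smul _
  have hap : ApproximatesLinearOn (fun v => T⁻¹ • A v)
      ((ContinuousLinearEquiv.refl ℝ E : E ≃L[ℝ] E) : E →L[ℝ] E) Set.univ (1 / 23) := by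
    intro v _ w _
    have := convex_univ.norm_image_sub_le_of_norm_hasFDerivWithin_le'
      (f := fun v => T⁻¹ • A v) (φ := ContinuousLinearMap.id ℝ E) (C := 1 / 23)
      (fun z _ => (hd z).hasFDerivWithinAt) (fun z _ => ?_) (Set.mem_univ w) (Set.mem_univ v)
    · simpa using this
    · refine ContinuousLinearMap.opNorm_le_bound _ (by norm_num) fun η => ?_
      have h1 : (T⁻¹ • A' z - ContinuousLinearMap.id ℝ E) η = T⁻¹ • (A' z η - T • η) := by
        simp [smul_sub, smul_smul, hT.ne']
      rw [h1, norm_smul, Real.norm_of_nonneg (by positivity)]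
      calc T⁻¹ * ‖A' z η - T • η‖ ≤ T⁻¹ * (T / 23 * ‖η‖) := by gcongr; exact hA' z η
        _ = 1 / 23 * ‖η‖ := by field_simp
  have hc : Subsingleton E ∨ (1 / 23 : NNReal)
      < ‖((ContinuousLinearEquiv.refl ℝ E).symm : E →L[ℝ] E)‖₊⁻¹ := by
    rcases (ContinuousLinearEquiv.refl ℝ E).subsingleton_or_nnnorm_symm_pos with h | h
    · exact Or.inl h
    · refine Or.inr (lt_of_lt_of_le (b := 1) ?_ ?_)
      · rw [← NNReal.coe_lt_coe]; norm_num
      · rw [one_le_inv₀ h]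
        exact ContinuousLinearMap.norm_id_le
  set e₁ := hap.toHomeomorph _ hc
  refine ⟨e₁.trans (Homeomorph.smulOfNeZero T hT.ne'), fun v => ?_⟩
  change T • (T⁻¹ • A v) = A v
  rw [smul_smul, mul_inv_cancel₀ hT.ne', one_smul]

variable [MeasurableSpace E] [BorelSpace E]

/-- One-shot coupling estimate: if velocities `v` and `w` steering `A` and `B` to the same point are
always close, and the derivatives of `A` and `B` at such velocities are close, then the laws of
`A ξ` and `B ξ` for Gaussian `ξ` have small relative entropy, here in dual form. -/
lemma integral_comp_add_one_sub_integral_exp_comp_le {T : ℝ} (hT : 0 < T) {A B : E → E}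
    {A' B' : E → E →L[ℝ] E}
    (hA : ∀ v, HasFDerivAt A (A' v) v) (hA' : ∀ v η, ‖A' v η - T • η‖ ≤ T / 23 * ‖η‖)
    (hB : ∀ v, HasFDerivAt B (B' v) v) (hB' : ∀ v η, ‖B' v η - T • η‖ ≤ T / 23 * ‖η‖)
    {a b : ℝ} (hb : 0 ≤ b) (ha : ∀ v w, A v = B w → ‖w - v‖ ≤ a)
    (hAB : ∀ v w, A v = B w → ∀ η, ‖A' v η - B' w η‖ ≤ b * ‖η‖)
    {n : ℕ} (hn : Module.finrank ℝ E = n) {g : E → ℝ}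
    (hg : Measurable g) {c : ℝ} (hgc : ∀ v, |g v| ≤ c) :
    ∫ v, g (A v) ∂(stdGaussian E) + 1 - ∫ w, Real.exp (g (B w)) ∂(stdGaussian E)
      ≤ a ^ 2 / 2 + 4 * n * (23 / 22 * (b / T)) ^ 2 := by
  obtain ⟨eA, heA⟩ := exists_homeomorph_of_deriv_near_smul hT hA hA'
  obtain ⟨eB, heB⟩ := exists_homeomorph_of_deriv_near_smul hT hB hB'
  have hlow : ∀ w η, 22 / 23 * T * ‖η‖ ≤ ‖B' w η‖ := by
    intro w η
    have h1 := hB' w η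
    have h2 : ‖T • η‖ ≤ ‖B' w η‖ + ‖B' w η - T • η‖ := by
      have := norm_sub_le (B' w η) (B' w η - T • η)
      simpa using this
    rw [norm_smul, Real.norm_of_nonneg hT.le] at h2
    linarith
  have hinj : ∀ w, LinearMap.ker (B' w : E →ₗ[ℝ] E) = ⊥ := by
    intro w
    rw [LinearMap.ker_eq_bot']
    intro η hη
    have h1 := hlow w η
    rw [show B' w η = 0 from hη, norm_zero] at h1
    have : 0 < 22 / 23 * T := by positivity
    exact norm_le_zero_iff.1 (by nlinarith [norm_nonneg η])
  let eB' : E → E ≃L[ℝ] E := fun w =>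
    (LinearEquiv.ofInjectiveEndo (B' w : E →ₗ[ℝ] E)
      (LinearMap.ker_eq_bot.1 (hinj w))).toContinuousLinearEquiv
  have heB' : ∀ w, (eB' w : E →L[ℝ] E) = B' w := fun w => by ext η; rfl
  -- `Φ v` is the velocity from which `B` reaches the point `A v`
  set Φ : E ≃ₜ E := eA.trans eB.symm with hΦdef
  have hΦ : ∀ v, A v = B (Φ v) := fun v => by
    rw [← heB, ← heA]; simp [hΦdef]
  set Φ' : E → E →L[ℝ] E := fun v => ((eB' (Φ v)).symm : E →L[ℝ] E).comp (A' v) with hΦ'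
  have hinv : ∀ z, HasFDerivAt eB.symm ((eB' (eB.symm z)).symm : E →L[ℝ] E) z := by
    intro z
    refine HasFDerivAt.of_local_left_inverse (f := eB) eB.symm.continuous.continuousAt ?_
      (Filter.Eventually.of_forall fun y => eB.apply_symm_apply y)
    rw [heB', show (eB : E → E) = B from funext heB]
    exact hB _
  have hΦd : ∀ v, HasFDerivAt Φ (Φ' v) v := by
    intro v
    have h1 : HasFDerivAt eA (A' v) v := by
      rw [show (eA : E → E) = A from funext heA]; exact hA v
    exact (hinv (eA v)).comp v h1
  have hBΦ : ∀ v η, B' (Φ v) ((Φ' v - 1) η) = A' v η - B' (Φ v) η := by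
    intro v η
    have : B' (Φ v) (Φ' v η) = A' v η := by
      rw [← heB']
      exact (eB' (Φ v)).apply_symm_apply _
    simp only [sub_apply, one_apply_eq_self, map_sub, this]
  have hbound : ∀ v (m : ℝ), 0 ≤ m → (∀ η, ‖A' v η - B' (Φ v) η‖ ≤ m * ‖η‖) →
      ‖Φ' v - 1‖ ≤ 23 / 22 * (m / T) := by
    intro v m hm h
    refine ContinuousLinearMap.opNorm_le_bound _ (by positivity) fun η => ?_
    have h1 := hlow (Φ v) ((Φ' v - 1) η)
    rw [hBΦ] at h1
    have h2 := h1.trans (h η)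
    have h3 : 23 / 22 * (m / T) * ‖η‖ = 23 / 22 / T * (m * ‖η‖) := by ring
    have h4 : ‖(Φ' v - 1) η‖ = 23 / 22 / T * (22 / 23 * T * ‖(Φ' v - 1) η‖) := by
      field_simp
    rw [h3, h4]
    gcongr
  have key := integral_add_one_sub_integral_exp_le_of_diffeo Φ hΦd
    (fun v => ha v (Φ v) (hΦ v)) (fun v => hbound v b hb (hAB v (Φ v) (hΦ v)))
    (fun v => (hbound v (2 * T / 23) (by positivity) fun η => ?_).trans ?_) hn
    (g := fun w => g (B w)) (hg.comp ?_) (b := c) (fun v => hgc _)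
  · simpa only [← hΦ] using key
  · have h1 := hA' v η
    have h2 := hB' (Φ v) η
    have h3 := norm_sub_le (A' v η - T • η) (B' (Φ v) η - T • η)
    rw [sub_sub_sub_cancel_right] at h3
    linarith
  · rw [show 23 / 22 * (2 * T / 23 / T) = (1 / 11 : ℝ) by field_simp; norm_num]
    norm_num
  · rw [← show (eB : E → E) = B from funext heB]; exact eB.continuous.measurable

end NearLinear

/-! ### Relative entropy: dual bound and transport inequality -/

section Entropy

open InformationTheory Filter Topology

/-- The tangent-line expression of `klFun` with the slope truncated is still nonnegative. -/
lemma mul_log_clamp_nonneg {s c N : ℝ} (hs : 0 ≤ s) (hc : 0 < c) (hc1 : c ≤ 1) (hN : 1 ≤ N) :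
    0 ≤ s * Real.log (max c (min s N)) + 1 - max c (min s N) := by
  rcases le_total s c with h | h
  · rw [max_eq_left ((min_le_left _ _).trans h)]
    have h1 := klFun_nonneg hc.le
    rw [klFun_apply] at h1
    nlinarith [Real.log_nonpos hc.le hc1]
  rcases le_total s N with h' | h'
  · rw [min_eq_left h', max_eq_right h]
    exact klFun_nonneg hs
  · rw [min_eq_right h', max_eq_right (hc1.trans hN)]
    have h1 := klFun_nonneg (zero_le_one.trans hN)
    rw [klFun_apply] at h1
    nlinarith [Real.log_nonneg hN]

lemma tendsto_mul_log_clamp {s : ℝ} (hs : 0 ≤ s) :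
    Tendsto (fun n : ℕ => s * Real.log (max (1 / ((n : ℝ) + 1)) (min s (n + 1))) + 1
      - max (1 / ((n : ℝ) + 1)) (min s (n + 1))) atTop (𝓝 (klFun s)) := by
  have h1 : Tendsto (fun n : ℕ => max (1 / ((n : ℝ) + 1)) (min s (n + 1))) atTop (𝓝 s) := by
    have h2 : Tendsto (fun n : ℕ => min s ((n : ℝ) + 1)) atTop (𝓝 s) := by
      refine tendsto_const_nhds.congr' ?_
      filter_upwards [eventually_ge_atTop ⌈s⌉₊] with n hn
      rw [min_eq_left]
      exact (Nat.le_ceil s).trans ((Nat.cast_le.2 hn).trans (by linarith))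
    have := tendsto_one_div_add_atTop_nhds_zero_nat (𝕜 := ℝ) |>.max h2
    rwa [max_eq_right hs] at this
  refine Tendsto.sub (Tendsto.add ?_ tendsto_const_nhds) h1
  rcases hs.eq_or_lt with rfl | hs
  · simp
  · exact (h1.log hs.ne').const_mul s

/-- The dual (Donsker–Varadhan type) characterization of relative entropy, in the direction that
bounds `klDiv`. -/
lemma klDiv_le_of_forall_bounded {Ω : Type*} [MeasurableSpace Ω] {ρ π : Measure Ω}
    [IsProbabilityMeasure ρ] [IsProbabilityMeasure π] {C : ℝ}
    (h : ∀ g : Ω → ℝ, Measurable g → (∃ b, ∀ x, |g x| ≤ b) →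
      ∫ x, g x ∂ρ + 1 - ∫ x, Real.exp (g x) ∂π ≤ C) :
    klDiv ρ π ≤ ENNReal.ofReal C := by
  -- testing with large multiples of the indicator of a `π`-null set shows that it is `ρ`-null
  have hac : ρ ≪ π := by
    refine Measure.AbsolutelyContinuous.mk fun s hs hπ => ?_
    by_contra hne
    have hpos : 0 < ρ.real s := by
      rw [measureReal_def]
      exact ENNReal.toReal_pos hne (measure_ne_top _ _)
    obtain ⟨n, hn⟩ := exists_nat_gt (C / ρ.real s)
    have h1 := h (s.indicator fun _ => (n : ℝ)) (measurable_const.indicator hs) ⟨n, fun x => by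
      by_cases hx : x ∈ s <;> simp [hx]⟩
    have h2 : ∫ x, Real.exp (s.indicator (fun _ => (n : ℝ)) x) ∂π = 1 := by
      have : (fun x => Real.exp (s.indicator (fun _ => (n : ℝ)) x)) =ᵐ[π] fun _ => 1 := by
        filter_upwards [measure_eq_zero_iff_ae_notMem.1 hπ] with x hx
        simp [hx]
      rw [integral_congr_ae this]
      simp
    rw [h2, integral_indicator_const _ hs, smul_eq_mul] at h1
    rw [div_lt_iff₀ hpos] at hn
    linarith
  rw [klDiv_eq_lintegral_klFun_of_ac hac]
  set s : Ω → ℝ := fun x => (ρ.rnDeriv π x).toReal with hs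
  have hsm : Measurable s := (ρ.measurable_rnDeriv π).ennreal_toReal
  have hs0 : ∀ x, 0 ≤ s x := fun x => ENNReal.toReal_nonneg
  -- the optimal test function `log s` is unbounded, so the density `s` is first truncated
  set t : ℕ → Ω → ℝ := fun n x => max (1 / ((n : ℝ) + 1)) (min (s x) (n + 1)) with ht
  have htm : ∀ n, Measurable (t n) := fun n => by fun_prop
  have htl : ∀ (n : ℕ) x, 1 / ((n : ℝ) + 1) ≤ t n x := fun n x => le_max_left _ _
  have ht0 : ∀ n x, 0 < t n x := fun n x => lt_of_lt_of_le (by positivity) (htl n x)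
  have hn1 : ∀ n : ℕ, 1 / ((n : ℝ) + 1) ≤ 1 := fun n => by
    rw [div_le_one (by positivity)]; linarith [(Nat.cast_nonneg n : (0 : ℝ) ≤ n)]
  have htu : ∀ (n : ℕ) x, t n x ≤ n + 1 := fun n x =>
    max_le ((hn1 n).trans (by linarith [(Nat.cast_nonneg n : (0 : ℝ) ≤ n)])) (min_le_right _ _)
  have hlog : ∀ n x, |Real.log (t n x)| ≤ Real.log (n + 1) := by
    intro n x
    rw [abs_le]
    constructor
    · rw [← Real.log_inv, inv_eq_one_div]
      exact Real.log_le_log (by positivity) (htl n x)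
    · exact Real.log_le_log (ht0 n x) (htu n x)
  have its : ∀ n, Integrable (t n) π := fun n =>
    Integrable.of_bound (htm n).aestronglyMeasurable (n + 1) (Eventually.of_forall fun x => by
      rw [Real.norm_of_nonneg (ht0 n x).le]; exact htu n x)
  have isl : ∀ n, Integrable (fun x => s x * Real.log (t n x)) π := fun n =>
    (Measure.integrable_toReal_rnDeriv (μ := ρ) (ν := π)).mul_bdd (c := Real.log (n + 1))
      (htm n).log.aestronglyMeasurable (Eventually.of_forall (hlog n))
  set ψ : ℕ → Ω → ℝ := fun n x => s x * Real.log (t n x) + 1 - t n x with hψ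
  have iψ : ∀ n, Integrable (ψ n) π := fun n => ((isl n).add (integrable_const 1)).sub (its n)
  have hψ0 : ∀ n x, 0 ≤ ψ n x := fun n x =>
    mul_log_clamp_nonneg (hs0 x) (by positivity) (hn1 n)
      (by linarith [(Nat.cast_nonneg n : (0 : ℝ) ≤ n)])
  have hψC : ∀ n, ∫ x, ψ n x ∂π ≤ C := by
    intro n
    have h1 := h (fun x => Real.log (t n x)) (htm n).log ⟨_, hlog n⟩
    simp only [Real.exp_log (ht0 n _)] at h1
    have h2 : ∫ x, ψ n x ∂π = ∫ x, s x * Real.log (t n x) ∂π + ∫ _, 1 ∂π - ∫ x, t n x ∂π := by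
      rw [← integral_add (isl n) (integrable_const 1)]
      exact integral_sub ((isl n).add (integrable_const 1)) (its n)
    rw [h2, integral_toReal_rnDeriv_mul hac]
    simpa using h1
  calc ∫⁻ x, ENNReal.ofReal (klFun (s x)) ∂π
      = ∫⁻ x, liminf (fun n => ENNReal.ofReal (ψ n x)) atTop ∂π := by
        congr 1
        ext x
        exact (ENNReal.tendsto_ofReal (tendsto_mul_log_clamp (hs0 x))).liminf_eq.symm
    _ ≤ liminf (fun n => ∫⁻ x, ENNReal.ofReal (ψ n x) ∂π) atTop := by
        refine lintegral_liminf_le fun n => ?_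
        exact (((hsm.mul (htm n).log).add_const 1).sub (htm n)).ennreal_ofReal
    _ ≤ ENNReal.ofReal C := by
        refine liminf_le_of_le (by isBoundedDefault) fun b hb => ?_
        obtain ⟨n, hn⟩ := hb.exists
        refine hn.trans ?_
        rw [← ofReal_integral_eq_lintegral_ofReal (iψ n) (Eventually.of_forall (hψ0 n))]
        exact ENNReal.ofReal_le_ofReal (hψC n)

/-- Kernels that regularize point masses, in the sense of a quadratic relative entropy bound in
dual form, satisfy an entropy–transport inequality. -/
lemma klDiv_bind_le_W₂ {d : ℕ} {P : Kernel (Space d) (Space d)} [IsMarkovKernel P] {C : ℝ}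
    (hC : 0 < C)
    (hP : ∀ x y, ∀ g : Space d → ℝ, Measurable g → (∃ b, ∀ z, |g z| ≤ b) →
      ∫ z, g z ∂(P x) + 1 - ∫ z, Real.exp (g z) ∂(P y) ≤ C * ‖x - y‖ ^ 2)
    (μ ν : Measure (Space d)) [IsProbabilityMeasure μ] [IsProbabilityMeasure ν] :
    klDiv (μ.bind P) (ν.bind P) ≤ ENNReal.ofReal C * W₂ μ ν ^ 2 := by
  have hW : W₂ μ ν ^ 2 = ⨅ γ ∈ couplings μ ν, ∫⁻ p, edist p.1 p.2 ^ 2 ∂γ := by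
    rw [W₂, ← ENNReal.rpow_natCast, ← ENNReal.rpow_mul]
    norm_num
  rw [hW, ENNReal.mul_iInf_of_ne (by simpa using hC) ENNReal.ofReal_ne_top]
  refine le_iInf fun γ => ?_
  rw [ENNReal.mul_iInf_of_ne (by simpa using hC) ENNReal.ofReal_ne_top]
  refine le_iInf fun hγ => ?_
  obtain ⟨h1, h2⟩ := hγ
  have hγp : IsProbabilityMeasure γ := ⟨by rw [← Measure.fst_univ, h1]; exact measure_univ⟩
  by_cases htop : ∫⁻ p, edist p.1 p.2 ^ 2 ∂γ = ∞
  · rw [htop, ENNReal.mul_top (by simpa using hC)]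
    exact le_top
  have hed : ∀ p : Space d × Space d, edist p.1 p.2 ^ 2 = ENNReal.ofReal (‖p.1 - p.2‖ ^ 2) := by
    intro p
    rw [edist_dist, dist_eq_norm, ENNReal.ofReal_pow (norm_nonneg _)]
  simp only [hed] at htop ⊢
  have hmeas : Measurable fun p : Space d × Space d => ‖p.1 - p.2‖ ^ 2 := by fun_prop
  have hint : Integrable (fun p : Space d × Space d => ‖p.1 - p.2‖ ^ 2) γ :=
    (lintegral_ofReal_ne_top_iff_integrable hmeas.aestronglyMeasurable
      (Eventually.of_forall fun p => by positivity)).1 htop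
  rw [← ofReal_integral_eq_lintegral_ofReal hint (Eventually.of_forall fun p => by positivity),
    ← ENNReal.ofReal_mul hC.le]
  refine klDiv_le_of_forall_bounded fun g hg ⟨b, hb⟩ => ?_
  have hbd : ∀ (ρ : Measure (Space d)) [IsProbabilityMeasure ρ], Integrable g ρ := fun ρ _ =>
    Integrable.of_bound hg.aestronglyMeasurable b (Eventually.of_forall fun z => hb z)
  have heb : ∀ z, ‖Real.exp (g z)‖ ≤ Real.exp b := fun z => by
    rw [Real.norm_of_nonneg (Real.exp_pos _).le]
    exact Real.exp_le_exp.2 ((le_abs_self _).trans (hb z))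
  have hbe : ∀ (ρ : Measure (Space d)) [IsProbabilityMeasure ρ],
      Integrable (fun z => Real.exp (g z)) ρ := fun ρ _ =>
    Integrable.of_bound hg.exp.aestronglyMeasurable (Real.exp b) (Eventually.of_forall heb)
  have m1 : StronglyMeasurable fun x => ∫ z, g z ∂(P x) :=
    hg.stronglyMeasurable.integral_kernel
  have m2 : StronglyMeasurable fun x => ∫ z, Real.exp (g z) ∂(P x) :=
    hg.exp.stronglyMeasurable.integral_kernel
  have j1 : Integrable (fun p : Space d × Space d => ∫ z, g z ∂(P p.1)) γ :=
    Integrable.of_bound (m1.comp_measurable measurable_fst).aestronglyMeasurable b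
      (Eventually.of_forall fun p => by
        have := norm_integral_le_of_norm_le_const (μ := P p.1) (f := g) (C := b)
          (Eventually.of_forall hb)
        simpa using this)
  have j2 : Integrable (fun p : Space d × Space d => ∫ z, Real.exp (g z) ∂(P p.2)) γ :=
    Integrable.of_bound (m2.comp_measurable measurable_snd).aestronglyMeasurable (Real.exp b)
      (Eventually.of_forall fun p => by
        have := norm_integral_le_of_norm_le_const (μ := P p.2) (Eventually.of_forall heb)
        simpa using this)
  have hcomp : ∀ (ρ : Measure (Space d)) [IsProbabilityMeasure ρ] {φ : Space d → ℝ},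
      Integrable φ (ρ.bind P) → ∫ z, φ z ∂(ρ.bind P) = ∫ x, ∫ z, φ z ∂(P x) ∂ρ := by
    intro ρ _ φ hφ
    rw [Measure.comp_eq_comp_const_apply] at hφ ⊢
    rw [Kernel.integral_comp hφ, Kernel.const_apply]
  have e1 : ∫ z, g z ∂(μ.bind P) = ∫ p, ∫ z, g z ∂(P p.1) ∂γ := by
    rw [hcomp _ (hbd _), ← h1, Measure.fst,
      integral_map measurable_fst.aemeasurable m1.aestronglyMeasurable]
  have e2 : ∫ z, Real.exp (g z) ∂(ν.bind P) = ∫ p, ∫ z, Real.exp (g z) ∂(P p.2) ∂γ := by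
    rw [hcomp _ (hbe _), ← h2, Measure.snd,
      integral_map measurable_snd.aemeasurable m2.aestronglyMeasurable]
  have e3 : ∫ p : Space d × Space d, (∫ z, g z ∂(P p.1) + 1 - ∫ z, Real.exp (g z) ∂(P p.2)) ∂γ
      = ∫ p, ∫ z, g z ∂(P p.1) ∂γ + ∫ _, 1 ∂γ - ∫ p, ∫ z, Real.exp (g z) ∂(P p.2) ∂γ := by
    rw [← integral_add j1 (integrable_const 1)]
    exact integral_sub (j1.add (integrable_const 1)) j2
  have e4 := integral_mono ((j1.add (integrable_const 1)).sub j2) (hint.const_mul C)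
    (fun p => hP p.1 p.2 g hg ⟨b, hb⟩)
  rw [integral_const_mul] at e4
  rw [e1, e2]
  have e5 := e3.symm.trans_le e4
  simpa using e5

end Entropy

/-! ### The gradient of the potential as a smooth force -/

section Gradient

variable {V : Type*} [NormedAddCommGroup V] [InnerProductSpace ℝ V] [CompleteSpace V]

/-- The inverse Riesz isomorphism as a real-linear map; `InnerProductSpace.toDual` is only
semilinear with respect to the conjugation of `ℝ`. -/
noncomputable def rieszInv : StrongDual ℝ V →L[ℝ] V :=
  LinearMap.mkContinuous
    { toFun := fun φ => (InnerProductSpace.toDual ℝ V).symm φ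
      map_add' := fun φ ψ => by simp
      map_smul' := fun c φ => by simp } 1 (fun φ => by simp)

lemma norm_rieszInv_comp_le (A : V →L[ℝ] StrongDual ℝ V) : ‖rieszInv.comp A‖ ≤ ‖A‖ := by
  refine ContinuousLinearMap.opNorm_le_bound _ (norm_nonneg A) fun η => ?_
  refine le_trans (le_of_eq ?_) (A.le_opNorm η)
  exact (InnerProductSpace.toDual ℝ V).symm.norm_map (A η)

lemma norm_sub_le_of_norm_iteratedFDeriv_one_le {W G : Type*} [NormedAddCommGroup W]
    [NormedSpace ℝ W] [NormedAddCommGroup G] [NormedSpace ℝ G] {u : W → G} (hu : Differentiable ℝ u)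
    {M : ℝ} (hM : ∀ z, ‖iteratedFDeriv ℝ 1 u z‖ ≤ M) (x y : W) : ‖u x - u y‖ ≤ M * ‖x - y‖ :=
  convex_univ.norm_image_sub_le_of_norm_hasFDerivWithin_le
    (fun z _ => (hu z).hasFDerivAt.hasFDerivWithinAt)
    (fun z _ => by rw [← norm_iteratedFDeriv_one]; exact hM z) (Set.mem_univ y) (Set.mem_univ x)

/-- The bounds on the second and third derivatives of the potential, transported to its gradient by
the Riesz isomorphism. -/
lemma PotentialRegularity.exists_isSmoothForce {d : ℕ} {f : Space d → ℝ} {L M : ℝ}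
    (hf : PotentialRegularity f L M) :
    ∃ (F : C(Space d, Space d)) (H : C(Space d, Space d →L[ℝ] Space d)),
      (∀ x, F x = gradient f x) ∧ IsSmoothForce F H L M := by
  have h1 : ContDiff ℝ 2 (fderiv ℝ f) := hf.contDiff.fderiv_right (by norm_num)
  have h2 : ContDiff ℝ 1 (fderiv ℝ (fderiv ℝ f)) := h1.fderiv_right (by norm_num)
  have hn2 : ∀ x, ‖fderiv ℝ (fderiv ℝ f) x‖ ≤ L := fun x => by
    rw [← norm_iteratedFDeriv_one, norm_iteratedFDeriv_fderiv]
    exact hf.norm_hessian_le x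
  have hn3 : ∀ x, ‖iteratedFDeriv ℝ 1 (fderiv ℝ (fderiv ℝ f)) x‖ ≤ M := fun x => by
    rw [norm_iteratedFDeriv_fderiv, norm_iteratedFDeriv_fderiv]
    exact hf.norm_third_le x
  refine ⟨⟨fun x => rieszInv (fderiv ℝ f x), rieszInv.continuous.comp h1.continuous⟩,
    ⟨fun x => rieszInv.comp (fderiv ℝ (fderiv ℝ f) x),
      continuous_const.clm_comp h2.continuous⟩, fun x => rfl, ?_, ?_, ?_⟩
  · intro x
    exact rieszInv.hasFDerivAt.comp x (h1.differentiable (by norm_num) x).hasFDerivAt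
  · exact fun x => (norm_rieszInv_comp_le _).trans (hn2 x)
  · intro x y
    refine le_trans ?_ (norm_sub_le_of_norm_iteratedFDeriv_one_le
      (h2.differentiable (by norm_num)) hn3 x y)
    change ‖rieszInv.comp _ - rieszInv.comp _‖ ≤ _
    rw [← ContinuousLinearMap.comp_sub]
    exact norm_rieszInv_comp_le _

end Gradient

/-! ### Regularization by one HMC transition -/

section Regularization

variable {X : Type*} [TopologicalSpace X] [CompactSpace X] {d : ℕ} {T L M : ℝ}
  (S : PathIntegrator X (Space d) T) {F : C(Space d, Space d)}
  {H : C(Space d, Space d →L[ℝ] Space d)}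

/-- The laws of the endpoints of the paths from `x` and from `y` with Gaussian velocities satisfy the
dual form of the relative entropy bound `(9 / (4 T²) + 20 d M² T⁴) ‖x - y‖²`. -/
lemma PathIntegrator.regularization (hF : IsSmoothForce F H L M) (hT : 0 < T)
    (hLT : L * T ^ 2 ≤ 1 / 12) (hM : 0 ≤ M) {q : Space d → Space d → C(X, Space d)}
    (hq : ∀ x v, S.IsPath F x v (q x v)) (x y : Space d) {g : Space d → ℝ} (hg : Measurable g)
    {c : ℝ} (hgc : ∀ z, |g z| ≤ c) :
    ∫ v, g (q x v S.endpoint) ∂(stdGaussian (Space d)) + 1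
        - ∫ w, Real.exp (g (q y w S.endpoint)) ∂(stdGaussian (Space d))
      ≤ (9 / (4 * T ^ 2) + 20 * d * M ^ 2 * T ^ 4) * ‖x - y‖ ^ 2 := by
  choose D hD using fun x v => S.exists_linear_solution hLT (hF.norm_comp_deriv_le (q x v))
  let ev : C(X, Space d) →L[ℝ] Space d := ContinuousMap.evalCLM ℝ S.endpoint
  have hder : ∀ x v, HasFDerivAt (fun v => q x v S.endpoint) (ev.comp (D x v)) v := fun x v =>
    ev.hasFDerivAt.comp v (S.hasFDerivAt_path hF hLT hM (hq x) (hD x v))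
  have hnear : ∀ x v η, ‖ev.comp (D x v) η - T • η‖ ≤ T / 23 * ‖η‖ := by
    intro x v η
    have h1 := (S.norm_le_of_linear_eq hLT (hF.norm_comp_deriv_le (q x v)) (hD x v η)).2
    have h2 := (D x v η - S.drift η).norm_coe_le_norm S.endpoint
    rw [ContinuousMap.sub_apply, PathIntegrator.drift_apply, S.time_endpoint] at h2
    have h3 := S.norm_drift_le η
    change ‖D x v η S.endpoint - T • η‖ ≤ _
    linarith
  set r := ‖x - y‖ with hr
  have key := integral_comp_add_one_sub_integral_exp_comp_le hT (hder x) (hnear x) (hder y)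
    (hnear y) (a := 12 / 11 * r / T) (b := 3 / 5 * M * T ^ 3 * (24 / 11 * r)) (by positivity)
    (fun v w hvw => ?_) (fun v w hvw η => ?_) finrank_euclideanSpace_fin hg hgc
  · refine key.trans ?_
    have e1 : (12 / 11 * r / T) ^ 2 / 2 = (72 / 121) / T ^ 2 * r ^ 2 := by ring
    have e2 : 4 * (d : ℝ) * (23 / 22 * (3 / 5 * M * T ^ 3 * (24 / 11 * r) / T)) ^ 2
        = 4 * (828 / 605) ^ 2 * (d * M ^ 2 * T ^ 4 * r ^ 2) := by
      field_simp
      ring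
    have e3 : (9 / (4 * T ^ 2) + 20 * d * M ^ 2 * T ^ 4) * r ^ 2
        = (9 / 4) / T ^ 2 * r ^ 2 + 20 * (d * M ^ 2 * T ^ 4 * r ^ 2) := by
      field_simp
    rw [e1, e2, e3]
    refine add_le_add ?_ (mul_le_mul_of_nonneg_right (by norm_num) (by positivity))
    refine mul_le_mul_of_nonneg_right ?_ (by positivity)
    exact div_le_div_of_nonneg_right (by norm_num) (by positivity)
  · have h1 := (S.boundary_value_estimates hF hLT (hq x v) (hq y w) hvw).1
    rw [norm_sub_rev, le_div_iff₀ hT]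
    linarith
  · have h1 := (S.boundary_value_estimates hF hLT (hq x v) (hq y w) hvw).2
    have h2 := S.norm_linear_sub_le hF hLT hM (hD x v η) (hD y w η)
    refine ((D x v η - D y w η).norm_coe_le_norm S.endpoint).trans (h2.trans ?_)
    gcongr

lemma PathIntegrator.continuous_endpoint (hF : IsSmoothForce F H L M)
    (hLT : L * T ^ 2 ≤ 1 / 12) {q : Space d → Space d → C(X, Space d)}
    (hq : ∀ x v, S.IsPath F x v (q x v)) :
    Continuous fun p : Space d × Space d => q p.1 p.2 S.endpoint := by
  have hT := S.nonneg
  have : LipschitzWith (Real.toNNReal (24 / 23 * (1 + T)))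
      fun p : Space d × Space d => q p.1 p.2 S.endpoint := by
    refine LipschitzWith.of_dist_le_mul fun p p' => ?_
    rw [dist_eq_norm, dist_eq_norm, Real.coe_toNNReal _ (by positivity)]
    refine ((q p.1 p.2 - q p'.1 p'.2).norm_coe_le_norm S.endpoint).trans ?_
    refine (S.norm_path_sub_le hF hLT (hq p.1 p.2) (hq p'.1 p'.2)).trans ?_
    have h1 : ‖p.1 - p'.1‖ ≤ ‖p - p'‖ := norm_fst_le (p - p')
    have h2 : ‖p.2 - p'.2‖ ≤ ‖p - p'‖ := norm_snd_le (p - p')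
    calc _ ≤ 24 / 23 * (‖p - p'‖ + T * ‖p - p'‖) := by gcongr
      _ = _ := by ring
  exact this.continuous

/-- One transition of HMC is regularizing as soon as the position map is the endpoint map of a
path integrator. -/
lemma PathIntegrator.uhmcKernel_regularization {f : Space d → ℝ} {h : ℝ}
    (hF : IsSmoothForce F H L M) (hT : 0 < T) (hLT : L * T ^ 2 ≤ 1 / 12) (hM : 0 ≤ M)
    (hpos : ∀ x v q, S.IsPath F x v q → positionMap f T h x v = q S.endpoint) :
    IsMarkovKernel (uhmcKernel f T h) ∧
    ∀ x y, ∀ g : Space d → ℝ, Measurable g → (∃ b, ∀ z, |g z| ≤ b) →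
      ∫ z, g z ∂(uhmcKernel f T h x) + 1 - ∫ z, Real.exp (g z) ∂(uhmcKernel f T h y)
        ≤ (9 / (4 * T ^ 2) + 20 * d * M ^ 2 * T ^ 4) * ‖x - y‖ ^ 2 := by
  choose q hq _ using fun x v => S.existsUnique_isPath hF hLT x v
  have hq' : ∀ x v, S.IsPath F x v (q x v) := hq
  have heq : (fun p : Space d × Space d => positionMap f T h p.1 p.2)
      = fun p => q p.1 p.2 S.endpoint := funext fun p => hpos _ _ _ (hq' p.1 p.2)
  have hmeas : Measurable fun p : Space d × Space d => q p.1 p.2 S.endpoint :=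
    (S.continuous_endpoint hF hLT hq').measurable
  have hker : ∀ x, uhmcKernel f T h x
      = (stdGaussian (Space d)).map fun v => q x v S.endpoint := by
    intro x
    rw [uhmcKernel, heq, Kernel.map_apply _ hmeas, Kernel.prod_apply, Kernel.id_apply,
      Kernel.const_apply, Measure.dirac_prod, Measure.map_map hmeas measurable_prodMk_left]
    rfl
  have hm : ∀ x, Measurable fun v => q x v S.endpoint := fun x =>
    hmeas.comp measurable_prodMk_left
  refine ⟨⟨fun x => ?_⟩, fun x y g hg ⟨b, hb⟩ => ?_⟩
  · rw [hker]
    exact Measure.isProbabilityMeasure_map (hm x).aemeasurable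
  · rw [hker, hker, integral_map (hm x).aemeasurable hg.aestronglyMeasurable,
      integral_map (hm y).aemeasurable hg.exp.aestronglyMeasurable]
    exact S.regularization hF hT hLT hM hq' x y hg hb

end Regularization

/-! ### The Verlet integrator -/

section Verlet

variable {V : Type*} [NormedAddCommGroup V] [NormedSpace ℝ V]

/-- The velocity decrement accumulated by `n` Verlet steps under the forces `-g 0, …, -g n`. -/
noncomputable def verletVelocity (h : ℝ) (g : ℕ → V) (n : ℕ) : V :=
  ∑ j ∈ Finset.range n, (h / 2) • (g j + g (j + 1))

/-- The position decrement accumulated by `n` Verlet steps under the forces `-g 0, …, -g n`. -/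
noncomputable def verletPosition (h : ℝ) (g : ℕ → V) (n : ℕ) : V :=
  ∑ j ∈ Finset.range n, (h • verletVelocity h g j + (h ^ 2 / 2) • g j)

lemma norm_verletVelocity_le {h : ℝ} (hh : 0 ≤ h) {g : ℕ → V} {b : ℝ} (hg : ∀ j, ‖g j‖ ≤ b)
    (n : ℕ) : ‖verletVelocity h g n‖ ≤ n * h * b := by
  have hsum : ∑ _j ∈ Finset.range n, h * b = n * h * b := by simp [mul_assoc]
  rw [← hsum]
  refine norm_sum_le_of_le _ fun j _ => ?_
  rw [norm_smul, Real.norm_of_nonneg (by positivity)]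
  calc h / 2 * ‖g j + g (j + 1)‖ ≤ h / 2 * (b + b) := by
        gcongr
        exact (norm_add_le _ _).trans (add_le_add (hg _) (hg _))
    _ = h * b := by ring

lemma norm_verletPosition_le {h : ℝ} (hh : 0 ≤ h) {g : ℕ → V} {b : ℝ} (hg : ∀ j, ‖g j‖ ≤ b)
    (n : ℕ) : ‖verletPosition h g n‖ ≤ (n * h) ^ 2 / 2 * b := by
  induction n with
  | zero => simp [verletPosition]
  | succ n ih =>
    rw [verletPosition, Finset.sum_range_succ, ← verletPosition]
    have h1 : ‖h • verletVelocity h g n + (h ^ 2 / 2) • g n‖ ≤ h * (n * h * b) + h ^ 2 / 2 * b := by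
      refine (norm_add_le _ _).trans ?_
      rw [norm_smul, norm_smul, Real.norm_of_nonneg hh, Real.norm_of_nonneg (by positivity)]
      gcongr
      · exact norm_verletVelocity_le hh hg n
      · exact hg n
    refine (norm_add_le _ _).trans ((add_le_add ih h1).trans (le_of_eq ?_))
    push_cast
    ring

lemma verletPosition_congr {h : ℝ} {g g' : ℕ → V} {n : ℕ} (hg : ∀ j < n, g j = g' j) :
    verletPosition h g n = verletPosition h g' n := by
  refine Finset.sum_congr rfl fun j hj => ?_
  rw [Finset.mem_range] at hj
  have : verletVelocity h g j = verletVelocity h g' j := by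
    refine Finset.sum_congr rfl fun i hi => ?_
    rw [Finset.mem_range] at hi
    rw [hg i (by omega), hg (i + 1) (by omega)]
  rw [this, hg j hj]

/-- The Verlet iterates in summed form: discrete counterpart of the integrated equation of motion. -/
lemma verletStep_iterate {d : ℕ} (f : Space d → ℝ) (h : ℝ) (x v : Space d) (n : ℕ) :
    (verletStep f h)^[n] (x, v) =
      (x + (n * h) • v
        - verletPosition h (fun j => gradient f ((verletStep f h)^[j] (x, v)).1) n,
      v - verletVelocity h (fun j => gradient f ((verletStep f h)^[j] (x, v)).1) n) := by
  induction n with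
  | zero => simp [verletPosition, verletVelocity]
  | succ n ih =>
    have h1 : ((verletStep f h)^[n + 1] (x, v)).1 = ((verletStep f h)^[n] (x, v)).1
        + h • ((verletStep f h)^[n] (x, v)).2
        - (h ^ 2 / 2) • gradient f ((verletStep f h)^[n] (x, v)).1 := by
      rw [Function.iterate_succ_apply']; rfl
    have h2 : ((verletStep f h)^[n + 1] (x, v)).2 = ((verletStep f h)^[n] (x, v)).2
        - (h / 2) • (gradient f ((verletStep f h)^[n] (x, v)).1
          + gradient f ((verletStep f h)^[n + 1] (x, v)).1) := by
      rw [Function.iterate_succ_apply']; rfl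
    set z : ℕ → Space d × Space d := fun n => (verletStep f h)^[n] (x, v) with hz
    have i1 : (z n).1 = _ := congrArg Prod.fst ih
    have i2 : (z n).2 = _ := congrArg Prod.snd ih
    change (z (n + 1)).1 = (z n).1 + h • (z n).2 - (h ^ 2 / 2) • gradient f (z n).1 at h1
    change (z (n + 1)).2 = (z n).2 - (h / 2) • (gradient f (z n).1 + gradient f (z (n + 1)).1) at h2
    change z (n + 1) = (x + ((n + 1 : ℕ) * h) • v
      - verletPosition h (fun j => gradient f (z j).1) (n + 1),
      v - verletVelocity h (fun j => gradient f (z j).1) (n + 1))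
    refine Prod.ext ?_ ?_
    · rw [h1, verletPosition, Finset.sum_range_succ, ← verletPosition]
      nth_rewrite 1 [i1]
      rw [i2]
      dsimp only
      push_cast
      module
    · rw [h2, verletVelocity, Finset.sum_range_succ, ← verletVelocity]
      nth_rewrite 1 [i2]
      dsimp only
      abel

/-- The Verlet integrator with `N` steps of size `h`, as a path integrator with time set
`{0, …, N}`. -/
noncomputable def verletIntegrator (V : Type*) [NormedAddCommGroup V] [NormedSpace ℝ V]
    {T h : ℝ} (hh : 0 ≤ h) (N : ℕ) (hN : T = N * h) : PathIntegrator (Fin (N + 1)) V T where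
  time := ⟨fun n => n * h, continuous_of_discreteTopology⟩
  endpoint := Fin.last N
  kernel := LinearMap.mkContinuous
    { toFun := fun q => ⟨fun n => verletPosition h (fun j => q (Fin.ofNat (N + 1) j)) n,
        continuous_of_discreteTopology⟩
      map_add' := fun p q => by
        ext n
        simp only [ContinuousMap.add_apply, ContinuousMap.coe_mk, verletPosition, verletVelocity,
          smul_add, Finset.sum_add_distrib]
        abel
      map_smul' := fun c q => by
        ext n
        simp only [ContinuousMap.smul_apply, ContinuousMap.coe_mk, verletPosition, verletVelocity,
          RingHom.id_apply, ← smul_add, smul_comm _ c, ← Finset.smul_sum] } (T ^ 2 / 2)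
    (fun q => by
      rw [ContinuousMap.norm_le _ (by positivity)]
      intro n
      refine (norm_verletPosition_le hh (fun j => q.norm_coe_le_norm _) n).trans ?_
      have : (n : ℝ) ≤ N := by exact_mod_cast Nat.lt_succ_iff.1 n.2
      rw [hN]
      gcongr)
  abs_time_le := fun n => by
    have : (n : ℝ) ≤ N := by exact_mod_cast Nat.lt_succ_iff.1 n.2
    rw [hN, ContinuousMap.coe_mk, abs_of_nonneg (by positivity)]
    gcongr
  time_endpoint := by simp [hN]
  norm_kernel_le := fun q => by
    refine (ContinuousLinearMap.le_opNorm _ _).trans ?_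
    gcongr
    exact LinearMap.mkContinuous_norm_le _ (by positivity) _

lemma positionMap_eq_of_isPath_verlet {d : ℕ} {f : Space d → ℝ} {T h L M : ℝ} (hh : 0 < h) {N : ℕ}
    (hN : T = N * h) {F : C(Space d, Space d)} {H : C(Space d, Space d →L[ℝ] Space d)}
    (hFf : ∀ x, F x = gradient f x) (hF : IsSmoothForce F H L M) (hLT : L * T ^ 2 ≤ 1 / 12)
    {x v : Space d} {q : C(Fin (N + 1), Space d)}
    (hq : (verletIntegrator (Space d) hh.le N hN).IsPath F x v q) :
    positionMap f T h x v = q (verletIntegrator (Space d) hh.le N hN).endpoint := by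
  set S := verletIntegrator (Space d) hh.le N hN
  let p : C(Fin (N + 1), Space d) :=
    ⟨fun n => ((verletStep f h)^[n] (x, v)).1, continuous_of_discreteTopology⟩
  have hp : S.IsPath F x v p := by
    ext1 n
    change ((verletStep f h)^[n] (x, v)).1 = x + ((n : ℕ) * h) • v
      - verletPosition h (fun j => F (p (Fin.ofNat (N + 1) j))) n
    rw [verletStep_iterate]
    dsimp only
    congr 1
    refine verletPosition_congr fun j hj => ?_
    rw [hFf]
    -- the indices `j < n ≤ N` occurring here are not wrapped around by `Fin.ofNat`
    change _ = gradient f ((verletStep f h)^[(Fin.ofNat (N + 1) j : ℕ)] (x, v)).1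
    rw [Fin.val_ofNat, Nat.mod_eq_of_lt (hj.trans n.2)]
  -- `T / h` is the integer `N`, so the floor in the step count loses nothing
  have hfloor : ⌊T / h⌋₊ = N := by rw [hN, mul_div_cancel_right₀ _ hh.ne', Nat.floor_natCast]
  rw [(S.existsUnique_isPath hF hLT x v).unique hq hp, positionMap, if_neg hh.ne', verletFlow,
    hfloor]
  rfl

end Verlet

/-! ### The exact flow -/

section ExtendPath

variable {V : Type*} [NormedAddCommGroup V]

/-- The extension of a path on `[0, T]` to `ℝ` that is constant on either side. -/
noncomputable def extendPath {T : ℝ} (hT : 0 ≤ T) (q : C(Set.Icc 0 T, V)) : ℝ → V :=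
  Set.IccExtend hT q

lemma continuous_extendPath {T : ℝ} (hT : 0 ≤ T) (q : C(Set.Icc 0 T, V)) :
    Continuous (extendPath hT q) := q.continuous.Icc_extend'

lemma extendPath_of_mem {T : ℝ} (hT : 0 ≤ T) (q : C(Set.Icc 0 T, V)) {s : ℝ}
    (hs : s ∈ Set.Icc 0 T) : extendPath hT q s = q ⟨s, hs⟩ := Set.IccExtend_of_mem hT q hs

lemma norm_extendPath_le {T : ℝ} (hT : 0 ≤ T) (q : C(Set.Icc 0 T, V)) (s : ℝ) :
    ‖extendPath hT q s‖ ≤ ‖q‖ := q.norm_coe_le_norm _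

end ExtendPath

section ExactFlow

open intervalIntegral

variable {V : Type*} [NormedAddCommGroup V] [NormedSpace ℝ V]

/-- The double primitive `s ↦ ∫₀ˢ ∫₀ʳ p(u) du dr`. -/
noncomputable def doublePrimitive (p : ℝ → V) (s : ℝ) : V :=
  ∫ r in (0 : ℝ)..s, ∫ u in (0 : ℝ)..r, p u

lemma norm_doublePrimitive_le {p : ℝ → V} {b : ℝ} (hb : ∀ u, ‖p u‖ ≤ b)
    {s : ℝ} (hs : 0 ≤ s) : ‖doublePrimitive p s‖ ≤ s ^ 2 / 2 * b := by
  have h1 : ‖doublePrimitive p s‖ ≤ ∫ r in (0 : ℝ)..s, r * b := by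
    refine norm_integral_le_of_norm_le hs (Filter.Eventually.of_forall fun r hr => ?_)
      ((continuous_id.mul continuous_const).intervalIntegrable _ _)
    have := norm_integral_le_of_norm_le_const (a := 0) (b := r) (f := p) (C := b)
      (fun u _ => hb u)
    rw [sub_zero, abs_of_pos hr.1] at this
    linarith
  rw [intervalIntegral.integral_mul_const, integral_id] at h1
  simpa using h1

lemma doublePrimitive_smul (c : ℝ) (p : ℝ → V) (s : ℝ) :
    doublePrimitive (fun u => c • p u) s = c • doublePrimitive p s := by
  simp only [doublePrimitive, intervalIntegral.integral_smul]

variable [CompleteSpace V]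

lemma hasDerivAt_primitive {p : ℝ → V} (hp : Continuous p) (s : ℝ) :
    HasDerivAt (fun r => ∫ u in (0 : ℝ)..r, p u) (p s) s :=
  integral_hasDerivAt_right (hp.intervalIntegrable _ _)
    (hp.stronglyMeasurableAtFilter _ _) hp.continuousAt

lemma continuous_primitive_of_continuous {p : ℝ → V} (hp : Continuous p) :
    Continuous fun r => ∫ u in (0 : ℝ)..r, p u :=
  continuous_iff_continuousAt.2 fun r => (hasDerivAt_primitive hp r).continuousAt

lemma hasDerivAt_doublePrimitive {p : ℝ → V} (hp : Continuous p) (s : ℝ) :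
    HasDerivAt (doublePrimitive p) (∫ u in (0 : ℝ)..s, p u) s :=
  hasDerivAt_primitive (continuous_primitive_of_continuous hp) s

lemma doublePrimitive_add {p q : ℝ → V} (hp : Continuous p) (hq : Continuous q) (s : ℝ) :
    doublePrimitive (fun u => p u + q u) s = doublePrimitive p s + doublePrimitive q s := by
  have h1 : ∀ r : ℝ, ∫ u in (0 : ℝ)..r, (p u + q u)
      = (∫ u in (0 : ℝ)..r, p u) + ∫ u in (0 : ℝ)..r, q u := fun r =>
    integral_add (hp.intervalIntegrable 0 r) (hq.intervalIntegrable 0 r)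
  simp only [doublePrimitive, h1]
  exact integral_add ((continuous_primitive_of_continuous hp).intervalIntegrable _ _)
    ((continuous_primitive_of_continuous hq).intervalIntegrable _ _)

/-- The exact integrator: the equation of motion on `[0, T]` in twice integrated form. -/
noncomputable def exactIntegrator (V : Type*) [NormedAddCommGroup V] [NormedSpace ℝ V]
    [CompleteSpace V] {T : ℝ} (hT : 0 ≤ T) : PathIntegrator (Set.Icc 0 T) V T where
  time := ⟨fun s => s, by fun_prop⟩
  endpoint := ⟨T, hT, le_rfl⟩
  kernel := LinearMap.mkContinuous
    { toFun := fun q => ⟨fun s => doublePrimitive (extendPath hT q) s,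
        (continuous_iff_continuousAt.2 fun s => (hasDerivAt_doublePrimitive
          (continuous_extendPath hT q) s).continuousAt).comp continuous_subtype_val⟩
      map_add' := fun p q => by
        ext s
        exact doublePrimitive_add (continuous_extendPath hT p) (continuous_extendPath hT q) s
      map_smul' := fun c q => by
        ext s
        exact doublePrimitive_smul c (extendPath hT q) s } (T ^ 2 / 2)
    (fun q => by
      rw [ContinuousMap.norm_le _ (by positivity)]
      intro s
      refine (norm_doublePrimitive_le (norm_extendPath_le hT q) s.2.1).trans ?_
      have h0 := s.2.1
      have h1 := s.2.2
      gcongr)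
  abs_time_le := fun s => by
    rw [ContinuousMap.coe_mk, abs_of_nonneg s.2.1]
    exact s.2.2
  time_endpoint := rfl
  norm_kernel_le := fun q => by
    refine (ContinuousLinearMap.le_opNorm _ _).trans ?_
    gcongr
    exact LinearMap.mkContinuous_norm_le _ (by positivity) _

lemma hamiltonianField_lipschitz {d : ℕ} {f : Space d → ℝ} {F : C(Space d, Space d)}
    {H : C(Space d, Space d →L[ℝ] Space d)} {L M : ℝ} (hFf : ∀ x, F x = gradient f x)
    (hF : IsSmoothForce F H L M) :
    LipschitzWith (Real.toNNReal (1 + L)) (hamiltonianField f) := by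
  have hL := hF.nonneg_left
  refine LipschitzWith.of_dist_le_mul fun z z' => ?_
  rw [dist_eq_norm, dist_eq_norm, Real.coe_toNNReal _ (by positivity), Prod.norm_def]
  have h1 : ‖z.1 - z'.1‖ ≤ ‖z - z'‖ := norm_fst_le (z - z')
  have h2 : ‖z.2 - z'.2‖ ≤ ‖z - z'‖ := norm_snd_le (z - z')
  have h0 := norm_nonneg (z - z')
  refine max_le ?_ ?_
  · change ‖z.2 - z'.2‖ ≤ _
    nlinarith
  · change ‖-gradient f z.1 - -gradient f z'.1‖ ≤ _
    rw [← hFf, ← hFf, neg_sub_neg, norm_sub_rev]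
    have := hF.norm_sub_le z.1 z'.1
    nlinarith

/-- Uniqueness of Hamiltonian trajectories, which makes the choice in `hamiltonianFlow`
immaterial. -/
lemma IsHamiltonianTrajectory.eq_at_end {d : ℕ} {f : Space d → ℝ} {F : C(Space d, Space d)}
    {H : C(Space d, Space d →L[ℝ] Space d)} {L M T : ℝ} (hFf : ∀ x, F x = gradient f x)
    (hF : IsSmoothForce F H L M) (hT : 0 ≤ T) {z : Space d × Space d}
    {γ γ' : ℝ → Space d × Space d} (h : IsHamiltonianTrajectory f T z γ)
    (h' : IsHamiltonianTrajectory f T z γ') : γ T = γ' T := by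
  have hder : ∀ {c : ℝ → Space d × Space d}, IsHamiltonianTrajectory f T z c →
      ∀ t ∈ Set.Ico 0 T, HasDerivWithinAt c (hamiltonianField f (c t)) (Set.Ici t) t :=
    fun hc t ht => (hc.2 t ⟨ht.1, ht.2.le⟩).mono_of_mem_nhdsWithin
      (Filter.mem_of_superset (Icc_mem_nhdsGE ht.2) (Set.Icc_subset_Icc_left ht.1))
  exact ODE_solution_unique (v := fun _ => hamiltonianField f)
    (fun _ => hamiltonianField_lipschitz hFf hF)
    (fun t ht => (h.2 t ht).continuousWithinAt) (hder h)
    (fun t ht => (h'.2 t ht).continuousWithinAt) (hder h') (h.1.trans h'.1.symm) ⟨hT, le_rfl⟩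

lemma positionMap_eq_of_isPath_exact {d : ℕ} {f : Space d → ℝ} {T L M : ℝ} (hT : 0 ≤ T)
    {F : C(Space d, Space d)} {H : C(Space d, Space d →L[ℝ] Space d)}
    (hFf : ∀ x, F x = gradient f x) (hF : IsSmoothForce F H L M)
    {x v : Space d} {q : C(Set.Icc 0 T, Space d)}
    (hq : (exactIntegrator (Space d) hT).IsPath F x v q) :
    positionMap f T 0 x v = q (exactIntegrator (Space d) hT).endpoint := by
  set p : ℝ → Space d := extendPath hT (F.comp q) with hp
  have hpc : Continuous p := continuous_extendPath hT _
  set γ : ℝ → Space d × Space d := fun t =>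
    (x + t • v - doublePrimitive p t, v - ∫ u in (0 : ℝ)..t, p u) with hγ
  have hqγ : ∀ t (ht : t ∈ Set.Icc 0 T), q ⟨t, ht⟩ = (γ t).1 := fun t ht =>
    congrArg (fun r : C(Set.Icc 0 T, Space d) => r ⟨t, ht⟩) hq
  have htraj : IsHamiltonianTrajectory f T (x, v) γ := by
    refine ⟨by simp [hγ, doublePrimitive], fun t ht => ?_⟩
    have h1 : HasDerivAt (fun t : ℝ => x + t • v - doublePrimitive p t)
        ((1 : ℝ) • v - ∫ u in (0 : ℝ)..t, p u) t :=
      (((hasDerivAt_id t).smul_const v).const_add x).sub (hasDerivAt_doublePrimitive hpc t)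
    have h2 : HasDerivAt (fun t : ℝ => v - ∫ u in (0 : ℝ)..t, p u) (-p t) t :=
      (hasDerivAt_primitive hpc t).const_sub v
    have h3 : hamiltonianField f (γ t) = ((1 : ℝ) • v - ∫ u in (0 : ℝ)..t, p u, -p t) := by
      rw [hamiltonianField, one_smul, ← hFf, ← hqγ t ht, hp, extendPath_of_mem hT _ ht]
      rfl
    change HasDerivWithinAt γ (hamiltonianField f (γ t)) _ t
    rw [h3]
    exact (h1.prodMk h2).hasDerivWithinAt
  have hex : ∃ γ, IsHamiltonianTrajectory f T (x, v) γ := ⟨γ, htraj⟩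
  rw [positionMap, if_pos rfl, hamiltonianFlow, dif_pos hex,
    IsHamiltonianTrajectory.eq_at_end hFf hF hT hex.choose_spec htraj]
  exact (hqγ T ⟨hT, le_rfl⟩).symm

end ExactFlow

/-! ### The entropy bound -/

/-- One transition of HMC is regularizing, for the exact flow and for the Verlet integrator. -/
lemma uhmcKernel_regularization {d : ℕ} {f : Space d → ℝ} {L M T h : ℝ}
    (hf : PotentialRegularity f L M) (hT : 0 < T) (hh : 0 ≤ h)
    (hdvd : 0 < h → ∃ N : ℕ, T = N * h) (hL : L * (T ^ 2 + T * h) ≤ 1 / 12) :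
    IsMarkovKernel (uhmcKernel f T h) ∧
    ∀ x y, ∀ g : Space d → ℝ, Measurable g → (∃ b, ∀ z, |g z| ≤ b) →
      ∫ z, g z ∂(uhmcKernel f T h x) + 1 - ∫ z, Real.exp (g z) ∂(uhmcKernel f T h y)
        ≤ (9 / (4 * T ^ 2) + 20 * d * M ^ 2 * T ^ 4) * ‖x - y‖ ^ 2 := by
  obtain ⟨F, H, hFf, hF⟩ := hf.exists_isSmoothForce
  have hM : 0 ≤ M := (norm_nonneg _).trans (hf.norm_third_le 0)
  have hLT : L * T ^ 2 ≤ 1 / 12 := by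
    have : 0 ≤ L * (T * h) := mul_nonneg hF.nonneg_left (by positivity)
    linarith
  rcases hh.eq_or_lt with rfl | hh
  · exact (exactIntegrator (Space d) hT.le).uhmcKernel_regularization hF hT hLT hM
      fun x v q hq => positionMap_eq_of_isPath_exact hT.le hFf hF hq
  · obtain ⟨N, hN⟩ := hdvd hh
    exact (verletIntegrator (Space d) hh.le N hN).uhmcKernel_regularization hF hT hLT hM
      fun x v q hq => positionMap_eq_of_isPath_verlet hh hN hFf hF hLT hq

lemma lawAfter_succ {d : ℕ} (P : Kernel (Space d) (Space d)) (k : ℕ) (μ : Measure (Space d)) :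
    lawAfter P (k + 1) μ = (lawAfter P k μ).bind P :=
  Function.iterate_succ_apply' _ _ _

lemma isProbabilityMeasure_lawAfter {d : ℕ} (P : Kernel (Space d) (Space d)) [IsMarkovKernel P]
    (μ : Measure (Space d)) [IsProbabilityMeasure μ] (k : ℕ) :
    IsProbabilityMeasure (lawAfter P k μ) := by
  induction k with
  | zero => assumption
  | succ k ih => rw [lawAfter_succ]; infer_instance

/-- The squared form of the mixing estimate, valid also for `k = 0`. -/
lemma W2Mixing.W₂_lawAfter_sq_le {d : ℕ} {P : Kernel (Space d) (Space d)} {ν : Measure (Space d)}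
    {c₁ c₂ : ℝ} (hmix : W2Mixing P ν c₁ c₂) (μ : Measure (Space d)) [IsProbabilityMeasure μ]
    (k : ℕ) :
    W₂ (lawAfter P k μ) ν ^ 2
      ≤ ENNReal.ofReal (c₁ ^ 2 * Real.exp (-2 * c₂ * k)) * W₂ μ ν ^ 2 := by
  have hc := hmix.one_le
  have h1 : W₂ (lawAfter P k μ) ν ≤ ENNReal.ofReal (c₁ * Real.exp (-c₂ * k)) * W₂ μ ν := by
    rcases Nat.eq_zero_or_pos k with rfl | hk
    · -- the mixing hypothesis starts at `k = 1`; for `k = 0` the bound holds because `1 ≤ c₁`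
      have : (1 : ℝ≥0∞) ≤ ENNReal.ofReal (c₁ * Real.exp (-c₂ * (0 : ℕ))) := by
        simpa using hc
      exact le_mul_of_one_le_left zero_le this
    · exact hmix.contraction k hk μ inferInstance
  refine (pow_le_pow_left' h1 2).trans (le_of_eq ?_)
  rw [mul_pow, ← ENNReal.ofReal_pow (by positivity), mul_pow, ← Real.exp_nat_mul]
  congr 4
  push_cast
  ring

end UHMC

theorem mainTheorem1 {d : ℕ} (f : UHMC.Space d → ℝ) (L M T h c₁ c₂ : ℝ)
    (hf : UHMC.PotentialRegularity f L M)
    (hT : 0 < T) (hh : 0 ≤ h) (hdvd : 0 < h → ∃ N : ℕ, T = N * h)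
    (hL : L * (T ^ 2 + T * h) ≤ 1 / 12)
    (ν : Measure (UHMC.Space d)) [IsProbabilityMeasure ν]
    (hmix : UHMC.W2Mixing (UHMC.uhmcKernel f T h) ν c₁ c₂)
    (μ : Measure (UHMC.Space d)) [IsProbabilityMeasure μ] (k : ℕ) :
    InformationTheory.klDiv (UHMC.lawAfter (UHMC.uhmcKernel f T h) (k + 1) μ) ν ≤
      ENNReal.ofReal (c₁ ^ 2 * Real.exp (-2 * c₂ * k) *
        (9 / (4 * T ^ 2) + 20 * d * M ^ 2 * T ^ 4)) * UHMC.W₂ μ ν ^ 2 := by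
  obtain ⟨hMarkov, hreg⟩ := UHMC.uhmcKernel_regularization hf hT hh hdvd hL
  have := UHMC.isProbabilityMeasure_lawAfter (UHMC.uhmcKernel f T h) μ k
  have hkey := UHMC.klDiv_bind_le_W₂ (by positivity) hreg
    (UHMC.lawAfter (UHMC.uhmcKernel f T h) k μ) ν
  rw [← UHMC.lawAfter_succ, hmix.invariant.def] at hkey
  refine hkey.trans ?_
  rw [mul_comm (c₁ ^ 2 * _), ENNReal.ofReal_mul (by positivity), mul_assoc (ENNReal.ofReal _)]
  exact mul_le_mul' le_rfl (hmix.W₂_lawAfter_sq_le μ k)
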